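/- Let $\mathcal C$ be a locally cartesian closed category (it suffices that $\mathcal C$ has pullbacks and that the pullback functor $f^*$ along the one map $f$ below has a right adjoint), and write $\mathbb{S}\mathrm{q}(\mathcal C)$ for the double category with objects the objects of $\mathcal C$, horizontal and vertical morphisms the morphisms of $\mathcal C$, and squares the commutative squares of $\mathcal C$. Let $\mathbb J,\mathbb K\to\mathbb{S}\mathrm{q}(\mathcal C)$ be (strict) double functors from (strict) double categories. A $(\mathbb J,\mathbb K)$-lifting operation $\phi$ chooses, for vertical morphisms $\mathbf j$ of $\mathbb J$ and $\mathbf k$ of $\mathbb K$ with underlying morphisms $j,k$ in $\mathcal C$, a diagonal filler $\phi_{\mathbf j,\mathbf k}(u,v)$ of every commutative square $(u,v):j\to k$, naturally in the squares of $\mathbb J$ and of $\mathbb K$ and compatibly with vertical composition in $\mathbb J$ and in $\mathbb K$. Let ${}^{\pitchfork\!\pitchfork}\mathbb K\to\mathbb{S}\mathrm{q}(\mathcal C)$ be the double category over $\mathbb{S}\mathrm{q}(\mathcal C)$ whose category of objects is $\mathcal C$, whose vertical morphisms are the morphisms of $\mathcal C$ equipped with a lifting operation against $\mathbb K$, and whose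 squares are the commutative squares that commute with the lifting operations; define $\mathbb J^{\pitchfork\!\pitchfork}\to\mathbb{S}\mathrm{q}(\mathcal C)$ dually. The lifting structure $(\mathbb J,\phi,\mathbb K)$ is called closed if the double functors $\mathbb J\to{}^{\pitchfork\!\pitchfork}\mathbb K$ and $\mathbb K\to\mathbb J^{\pitchfork\!\pitchfork}$ induced by $\phi$ are isomorphisms of double categories; for example, every lifting algebraic weak factorisation system is a closed lifting structure. For an object $A$ of $\mathcal C$, the slice $\mathbb J/A\to\mathbb{S}\mathrm{q}(\mathcal C/A)$ is the pullback of $\mathbb J\to\mathbb{S}\mathrm{q}(\mathcal C)$ along $\mathbb{S}\mathrm{q}(\mathrm{dom}):\mathbb{S}\mathrm{q}(\mathcal C/A)\to\mathbb{S}\mathrm{q}(\mathcal C)$, and $\phi$ induces a $(\mathbb J/A,\mathbb K/A)$-lifting operation $\phi/A$ that takes the fillers in $\mathcal C$. Let $(\mathbb J,\phi,\mathbb K)$ be a closed lifting structure, let $f:A\to B$ be a map in $\mathcal C$, and let $f^*\dashv f_*:\mathcal C/A\to\mathcal C/B$ be pullback and pushforward along $f$. A Frobenius structure on $f$ is a double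 functor $\mathbf f^*:\mathbb J/B\to\mathbb J/A$ lying strictly over $\mathbb{S}\mathrm{q}(f^*):\mathbb{S}\mathrm{q}(\mathcal C/B)\to\mathbb{S}\mathrm{q}(\mathcal C/A)$, and a pushforward structure on $f$ is a double functor $\mathbf f_*:\mathbb K/A\to\mathbb K/B$ lying strictly over $\mathbb{S}\mathrm{q}(f_*):\mathbb{S}\mathrm{q}(\mathcal C/A)\to\mathbb{S}\mathrm{q}(\mathcal C/B)$. Then there is a bijection between Frobenius structures $\mathbf f^*$ and pushforward structures $\mathbf f_*$ on $f$. It can be chosen to be given by transposition along $f^*\dashv f_*$: whenever $\mathbf f^*$ corresponds to $\mathbf f_*$, for all vertical morphisms $\mathbf j$ of $\mathbb J/B$ and $\mathbf k$ of $\mathbb K/A$ and every commutative square $(u,v):f^*j\to k$ in $\mathcal C/A$ with transpose $(\bar u,\bar v):j\to f_*k$ in $\mathcal C/B$, the transpose of the filler $(\phi/A)_{\mathbf f^*\mathbf j,\,\mathbf k}(u,v)$ is the filler $(\phi/B)_{\mathbf j,\,\mathbf f_*\mathbf k}(\bar u,\bar v)$. -/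

import Mathlib

open CategoryTheory Limits

universe v u v₁ u₁ v₂ u₂ o h w s o₁ h₁ w₁ s₁ o₂ h₂ w₂ s₂ o₃ h₃ w₃ s₃ o₄ h₄ w₄ s₄

namespace DoubleLifting

/-! ### Double categories and double functors -/

/-- A vertical arrow together with its source and target. For the family of hom-sets of a category
this is an object of the arrow category. -/
structure VertArrow {O : Type o} (V : O → O → Type w) where
  src : O
  tgt : O
  arr : V src tgt

/-- A (strict) double category, i.e. an internal category in categories: a category `Obj` of objects
and horizontal morphisms, a category `VertArrow Vert` of vertical morphisms and squares, source and
target functors (the object parts are `VertArrow.src` and `VertArrow.tgt`, the morphism parts are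
`top` and `bot`), an identity functor (`vid`, `vidSq`) and a composition functor
(`vcomp`, `vcompSq`), subject to the strict axioms of a category. Vertical composition is written in
diagrammatic order. -/
structure DoubleCategory where
  /-- objects -/
  Obj : Type o
  /-- horizontal morphisms -/
  [horCategory : Category.{h} Obj]
  /-- vertical morphisms -/
  Vert : Obj → Obj → Type w
  /-- squares, with their horizontal composition -/
  [sqCategory : Category.{s} (VertArrow Vert)]
  /-- the source functor on squares -/
  top : ∀ {x y : VertArrow Vert}, (x ⟶ y) → (x.src ⟶ y.src)
  top_id : ∀ x : VertArrow Vert, top (𝟙 x) = 𝟙 x.src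
  top_comp : ∀ {x y z : VertArrow Vert} (α : x ⟶ y) (β : y ⟶ z), top (α ≫ β) = top α ≫ top β
  /-- the target functor on squares -/
  bot : ∀ {x y : VertArrow Vert}, (x ⟶ y) → (x.tgt ⟶ y.tgt)
  bot_id : ∀ x : VertArrow Vert, bot (𝟙 x) = 𝟙 x.tgt
  bot_comp : ∀ {x y z : VertArrow Vert} (α : x ⟶ y) (β : y ⟶ z), bot (α ≫ β) = bot α ≫ bot β
  /-- vertical identities -/
  vid : ∀ a : Obj, Vert a a
  /-- vertical identity squares -/
  vidSq : ∀ {a b : Obj}, (a ⟶ b) → ((⟨a, a, vid a⟩ : VertArrow Vert) ⟶ ⟨b, b, vid b⟩)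
  vidSq_id : ∀ a : Obj, vidSq (𝟙 a) = 𝟙 (⟨a, a, vid a⟩ : VertArrow Vert)
  vidSq_comp : ∀ {a b c : Obj} (k : a ⟶ b) (l : b ⟶ c), vidSq (k ≫ l) = vidSq k ≫ vidSq l
  top_vidSq : ∀ {a b : Obj} (k : a ⟶ b), top (vidSq k) = k
  bot_vidSq : ∀ {a b : Obj} (k : a ⟶ b), bot (vidSq k) = k
  /-- vertical composition of vertical morphisms -/
  vcomp : ∀ {a b c : Obj}, Vert a b → Vert b c → Vert a c
  /-- vertical composition of squares -/
  vcompSq : ∀ {a b c a' b' c' : Obj} {f : Vert a b} {g : Vert b c} {f' : Vert a' b'}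
    {g' : Vert b' c'} (α : (⟨a, b, f⟩ : VertArrow Vert) ⟶ ⟨a', b', f'⟩)
    (β : (⟨b, c, g⟩ : VertArrow Vert) ⟶ ⟨b', c', g'⟩), bot α = top β →
    ((⟨a, c, vcomp f g⟩ : VertArrow Vert) ⟶ ⟨a', c', vcomp f' g'⟩)
  top_vcompSq : ∀ {a b c a' b' c' : Obj} {f : Vert a b} {g : Vert b c} {f' : Vert a' b'}
    {g' : Vert b' c'} (α : (⟨a, b, f⟩ : VertArrow Vert) ⟶ ⟨a', b', f'⟩)
    (β : (⟨b, c, g⟩ : VertArrow Vert) ⟶ ⟨b', c', g'⟩) (e : bot α = top β),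
    top (vcompSq α β e) = top α
  bot_vcompSq : ∀ {a b c a' b' c' : Obj} {f : Vert a b} {g : Vert b c} {f' : Vert a' b'}
    {g' : Vert b' c'} (α : (⟨a, b, f⟩ : VertArrow Vert) ⟶ ⟨a', b', f'⟩)
    (β : (⟨b, c, g⟩ : VertArrow Vert) ⟶ ⟨b', c', g'⟩) (e : bot α = top β),
    bot (vcompSq α β e) = bot β
  vcompSq_id : ∀ {a b c : Obj} (f : Vert a b) (g : Vert b c),
    vcompSq (𝟙 (⟨a, b, f⟩ : VertArrow Vert)) (𝟙 (⟨b, c, g⟩ : VertArrow Vert))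
      ((bot_id ⟨a, b, f⟩).trans (top_id ⟨b, c, g⟩).symm) = 𝟙 _
  vcompSq_comp : ∀ {a b c a' b' c' a'' b'' c'' : Obj} {f : Vert a b} {g : Vert b c}
    {f' : Vert a' b'} {g' : Vert b' c'} {f'' : Vert a'' b''} {g'' : Vert b'' c''}
    (α : (⟨a, b, f⟩ : VertArrow Vert) ⟶ ⟨a', b', f'⟩)
    (β : (⟨b, c, g⟩ : VertArrow Vert) ⟶ ⟨b', c', g'⟩) (e : bot α = top β)
    (α' : (⟨a', b', f'⟩ : VertArrow Vert) ⟶ ⟨a'', b'', f''⟩)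
    (β' : (⟨b', c', g'⟩ : VertArrow Vert) ⟶ ⟨b'', c'', g''⟩) (e' : bot α' = top β'),
    vcompSq (α ≫ α') (β ≫ β') (by rw [bot_comp, top_comp, e, e']) =
      vcompSq α β e ≫ vcompSq α' β' e'
  vid_vcomp : ∀ {a b : Obj} (f : Vert a b), vcomp (vid a) f = f
  vcomp_vid : ∀ {a b : Obj} (f : Vert a b), vcomp f (vid b) = f
  vcomp_assoc : ∀ {a b c d : Obj} (f : Vert a b) (g : Vert b c) (k : Vert c d),
    vcomp (vcomp f g) k = vcomp f (vcomp g k)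
  vidSq_vcompSq : ∀ {a b a' b' : Obj} {f : Vert a b} {f' : Vert a' b'}
    (α : (⟨a, b, f⟩ : VertArrow Vert) ⟶ ⟨a', b', f'⟩),
    HEq (vcompSq (vidSq (top α)) α (bot_vidSq _)) α
  vcompSq_vidSq : ∀ {a b a' b' : Obj} {f : Vert a b} {f' : Vert a' b'}
    (α : (⟨a, b, f⟩ : VertArrow Vert) ⟶ ⟨a', b', f'⟩),
    HEq (vcompSq α (vidSq (bot α)) (top_vidSq _).symm) α
  vcompSq_assoc : ∀ {a b c d a' b' c' d' : Obj} {f : Vert a b} {g : Vert b c} {k : Vert c d}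
    {f' : Vert a' b'} {g' : Vert b' c'} {k' : Vert c' d'}
    (α : (⟨a, b, f⟩ : VertArrow Vert) ⟶ ⟨a', b', f'⟩)
    (β : (⟨b, c, g⟩ : VertArrow Vert) ⟶ ⟨b', c', g'⟩)
    (γ : (⟨c, d, k⟩ : VertArrow Vert) ⟶ ⟨c', d', k'⟩) (e : bot α = top β) (e' : bot β = top γ),
    HEq (vcompSq (vcompSq α β e) γ ((bot_vcompSq α β e).trans e'))
      (vcompSq α (vcompSq β γ e') (e.trans (top_vcompSq β γ e').symm))

attribute [instance] DoubleCategory.horCategory DoubleCategory.sqCategory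

/-- A (strict) double functor, i.e. an internal functor between internal categories in
categories. -/
@[ext]
structure DoubleFunctor (D : DoubleCategory.{o₁, h₁, w₁, s₁})
    (E : DoubleCategory.{o₂, h₂, w₂, s₂}) where
  /-- the functor on objects and horizontal morphisms -/
  hor : D.Obj ⥤ E.Obj
  /-- the action on vertical morphisms -/
  vert : ∀ {a b : D.Obj}, D.Vert a b → E.Vert (hor.obj a) (hor.obj b)
  /-- the action on squares -/
  sq : ∀ {x y : VertArrow D.Vert}, (x ⟶ y) →
    ((⟨hor.obj x.src, hor.obj x.tgt, vert x.arr⟩ : VertArrow E.Vert) ⟶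
      ⟨hor.obj y.src, hor.obj y.tgt, vert y.arr⟩)
  sq_id : ∀ x : VertArrow D.Vert, sq (𝟙 x) = 𝟙 _
  sq_comp : ∀ {x y z : VertArrow D.Vert} (α : x ⟶ y) (β : y ⟶ z), sq (α ≫ β) = sq α ≫ sq β
  top_sq : ∀ {x y : VertArrow D.Vert} (α : x ⟶ y), E.top (sq α) = hor.map (D.top α)
  bot_sq : ∀ {x y : VertArrow D.Vert} (α : x ⟶ y), E.bot (sq α) = hor.map (D.bot α)
  vert_vid : ∀ a : D.Obj, vert (D.vid a) = E.vid (hor.obj a)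
  vert_vcomp : ∀ {a b c : D.Obj} (f : D.Vert a b) (g : D.Vert b c),
    vert (D.vcomp f g) = E.vcomp (vert f) (vert g)
  sq_vidSq : ∀ {a b : D.Obj} (k : a ⟶ b), HEq (sq (D.vidSq k)) (E.vidSq (hor.map k))
  sq_vcompSq : ∀ {a b c a' b' c' : D.Obj} {f : D.Vert a b} {g : D.Vert b c} {f' : D.Vert a' b'}
    {g' : D.Vert b' c'} (α : (⟨a, b, f⟩ : VertArrow D.Vert) ⟶ ⟨a', b', f'⟩)
    (β : (⟨b, c, g⟩ : VertArrow D.Vert) ⟶ ⟨b', c', g'⟩) (e : D.bot α = D.top β),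
    HEq (sq (D.vcompSq α β e))
      (E.vcompSq (sq α) (sq β) (by rw [bot_sq, top_sq, e]))

namespace DoubleFunctor

/-- The action of a double functor on bundled vertical morphisms. -/
@[reducible]
def vertArrow {D : DoubleCategory.{o₁, h₁, w₁, s₁}} {E : DoubleCategory.{o₂, h₂, w₂, s₂}}
    (F : DoubleFunctor D E) (x : VertArrow D.Vert) : VertArrow E.Vert :=
  ⟨F.hor.obj x.src, F.hor.obj x.tgt, F.vert x.arr⟩

/-- The identity double functor. -/
def id (D : DoubleCategory.{o₁, h₁, w₁, s₁}) : DoubleFunctor D D where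
  hor := 𝟭 _
  vert f := f
  sq α := α
  sq_id _ := rfl
  sq_comp _ _ := rfl
  top_sq _ := rfl
  bot_sq _ := rfl
  vert_vid _ := rfl
  vert_vcomp _ _ := rfl
  sq_vidSq _ := HEq.rfl
  sq_vcompSq _ _ _ := HEq.rfl

/-- Two squares of a double category that are transported along equalities of vertical
morphisms have the same images up to `HEq`. -/
theorem sq_heq {D : DoubleCategory.{o₁, h₁, w₁, s₁}} {E : DoubleCategory.{o₂, h₂, w₂, s₂}}
    (F : DoubleFunctor D E) {a b a' b' : D.Obj} {f₁ f₂ : D.Vert a b} {g₁ g₂ : D.Vert a' b'}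
    (hf : f₁ = f₂) (hg : g₁ = g₂)
    {α₁ : (⟨a, b, f₁⟩ : VertArrow D.Vert) ⟶ ⟨a', b', g₁⟩}
    {α₂ : (⟨a, b, f₂⟩ : VertArrow D.Vert) ⟶ ⟨a', b', g₂⟩} (hα : HEq α₁ α₂) :
    HEq (F.sq α₁) (F.sq α₂) := by
  subst hf hg
  cases hα
  rfl

/-- Composition of double functors. -/
def comp {D : DoubleCategory.{o₁, h₁, w₁, s₁}} {E : DoubleCategory.{o₂, h₂, w₂, s₂}}
    {E' : DoubleCategory.{o₃, h₃, w₃, s₃}} (F : DoubleFunctor D E) (G : DoubleFunctor E E') :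
    DoubleFunctor D E' where
  hor := F.hor ⋙ G.hor
  vert f := G.vert (F.vert f)
  sq α := G.sq (F.sq α)
  sq_id x := by rw [F.sq_id, G.sq_id]; rfl
  sq_comp α β := by rw [F.sq_comp, G.sq_comp]
  top_sq α := by rw [G.top_sq, F.top_sq]; rfl
  bot_sq α := by rw [G.bot_sq, F.bot_sq]; rfl
  vert_vid a := by rw [F.vert_vid, G.vert_vid]; rfl
  vert_vcomp f g := by rw [F.vert_vcomp, G.vert_vcomp]
  sq_vidSq k :=
    (G.sq_heq (F.vert_vid _) (F.vert_vid _) (F.sq_vidSq k)).trans (G.sq_vidSq _)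
  sq_vcompSq α β e :=
    (G.sq_heq (F.vert_vcomp _ _) (F.vert_vcomp _ _) (F.sq_vcompSq α β e)).trans
      (G.sq_vcompSq _ _ _)

/-- A double functor is invertible if it has a (strict) two-sided inverse double functor. -/
def IsInvertible {D : DoubleCategory.{o₁, h₁, w₁, s₁}} {E : DoubleCategory.{o₂, h₂, w₂, s₂}}
    (F : DoubleFunctor D E) : Prop :=
  ∃ G : DoubleFunctor E D, F.comp G = DoubleFunctor.id D ∧ G.comp F = DoubleFunctor.id E

end DoubleFunctor

/-! ### The double category of squares -/

/-- A commutative square from the arrow `x` to the arrow `y`. -/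
@[ext]
structure SqHom {C : Type u} [Category.{v} C] (x y : VertArrow (fun X Y : C => X ⟶ Y)) where
  top : x.src ⟶ y.src
  bot : x.tgt ⟶ y.tgt
  comm : top ≫ y.arr = x.arr ≫ bot

/-- The arrow category of `C`. -/
instance arrowCategory (C : Type u) [Category.{v} C] :
    Category.{v} (VertArrow (fun X Y : C => X ⟶ Y)) where
  Hom x y := SqHom x y
  id x := ⟨𝟙 _, 𝟙 _, by simp⟩
  comp α β := ⟨α.top ≫ β.top, α.bot ≫ β.bot, by
    rw [Category.assoc, β.comm, ← Category.assoc, α.comm, Category.assoc]⟩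
  id_comp α := by apply SqHom.ext <;> simp
  comp_id α := by apply SqHom.ext <;> simp
  assoc α β γ := by apply SqHom.ext <;> simp

theorem SqHom.heq {C : Type u} [Category.{v} C] {X Y X' Y' : C} {f₁ f₂ : X ⟶ Y}
    {g₁ g₂ : X' ⟶ Y'} (hf : f₁ = f₂) (hg : g₁ = g₂)
    (α₁ : SqHom (⟨X, Y, f₁⟩ : VertArrow (fun X Y : C => X ⟶ Y)) ⟨X', Y', g₁⟩)
    (α₂ : SqHom (⟨X, Y, f₂⟩ : VertArrow (fun X Y : C => X ⟶ Y)) ⟨X', Y', g₂⟩)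
    (ht : α₁.top = α₂.top) (hb : α₁.bot = α₂.bot) : HEq α₁ α₂ := by
  subst hf hg
  exact heq_of_eq (SqHom.ext ht hb)

/-- Vertical composition of commutative squares. -/
@[reducible]
def SqHom.vcomp {C : Type u} [Category.{v} C] {X Y Z X' Y' Z' : C} {f : X ⟶ Y} {g : Y ⟶ Z}
    {f' : X' ⟶ Y'} {g' : Y' ⟶ Z'}
    (α : SqHom (⟨X, Y, f⟩ : VertArrow (fun X Y : C => X ⟶ Y)) ⟨X', Y', f'⟩)
    (β : SqHom (⟨Y, Z, g⟩ : VertArrow (fun X Y : C => X ⟶ Y)) ⟨Y', Z', g'⟩)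
    (e : α.bot = β.top) :
    SqHom (⟨X, Z, f ≫ g⟩ : VertArrow (fun X Y : C => X ⟶ Y)) ⟨X', Z', f' ≫ g'⟩ where
  top := α.top
  bot := β.bot
  comm := by
    have h₁ := α.comm
    have h₂ := β.comm
    dsimp only at h₁ h₂ e ⊢
    rw [← Category.assoc, h₁, Category.assoc, e, h₂, Category.assoc]

/-- The double category of squares in `C`: its category of objects is `C`, its category of arrows
is the arrow category of `C`. -/
@[reducible]
def Sq (C : Type u) [Category.{v} C] : DoubleCategory.{u, v, v, v} where
  Obj := C
  Vert X Y := X ⟶ Y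
  top α := SqHom.top α
  top_id _ := rfl
  top_comp _ _ := rfl
  bot α := SqHom.bot α
  bot_id _ := rfl
  bot_comp _ _ := rfl
  vid X := 𝟙 X
  vidSq k := SqHom.mk k k (by simp)
  vidSq_id _ := rfl
  vidSq_comp _ _ := rfl
  top_vidSq _ := rfl
  bot_vidSq _ := rfl
  vcomp f g := f ≫ g
  vcompSq α β e := SqHom.vcomp α β e
  top_vcompSq _ _ _ := rfl
  bot_vcompSq _ _ _ := rfl
  vcompSq_id _ _ := rfl
  vcompSq_comp _ _ _ _ _ _ := rfl
  vid_vcomp f := Category.id_comp f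
  vcomp_vid f := Category.comp_id f
  vcomp_assoc f g k := Category.assoc f g k
  vidSq_vcompSq _ := SqHom.heq (Category.id_comp _) (Category.id_comp _) _ _ rfl rfl
  vcompSq_vidSq _ := SqHom.heq (Category.comp_id _) (Category.comp_id _) _ _ rfl rfl
  vcompSq_assoc _ _ _ _ _ :=
    SqHom.heq (Category.assoc _ _ _) (Category.assoc _ _ _) _ _ rfl rfl

/-- The double functor between double categories of squares induced by a functor. -/
def Sq.map {C : Type u₁} [Category.{v₁} C] {D : Type u₂} [Category.{v₂} D] (H : C ⥤ D) :
    DoubleFunctor (Sq C) (Sq D) where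
  hor := H
  vert f := H.map f
  sq α := SqHom.mk (H.map (SqHom.top α)) (H.map (SqHom.bot α)) (by
    rw [← H.map_comp, SqHom.comm α, H.map_comp])
  sq_id x := SqHom.ext (H.map_id _) (H.map_id _)
  sq_comp α β := SqHom.ext (H.map_comp _ _) (H.map_comp _ _)
  top_sq _ := rfl
  bot_sq _ := rfl
  vert_vid X := H.map_id X
  vert_vcomp f g := H.map_comp f g
  sq_vidSq _ := SqHom.heq (H.map_id _) (H.map_id _) _ _ rfl rfl
  sq_vcompSq _ _ _ := SqHom.heq (H.map_comp _ _) (H.map_comp _ _) _ _ rfl rfl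

/-- A double category over the double category of squares in `C`. -/
structure DoubleOver (C : Type u) [Category.{v} C] where
  /-- the underlying double category -/
  dom : DoubleCategory.{o, h, w, s}
  /-- the double functor to the squares of `C` -/
  toSq : DoubleFunctor dom (Sq C)

namespace DoubleOver

variable {C : Type u} [Category.{v} C] (J : DoubleOver.{v, u, o, h, w, s} C)

/-- The underlying object of `C`. -/
abbrev ob (a : J.dom.Obj) : C := J.toSq.hor.obj a

/-- The underlying morphism of `C` of a horizontal morphism. -/
abbrev hor {a b : J.dom.Obj} (k : a ⟶ b) : J.ob a ⟶ J.ob b := J.toSq.hor.map k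

/-- The underlying morphism of `C` of a vertical morphism. -/
abbrev ver {a b : J.dom.Obj} (f : J.dom.Vert a b) : J.ob a ⟶ J.ob b := J.toSq.vert f

theorem hor_id (a : J.dom.Obj) : J.hor (𝟙 a) = 𝟙 (J.ob a) := J.toSq.hor.map_id a

theorem hor_comp {a b c : J.dom.Obj} (k : a ⟶ b) (l : b ⟶ c) :
    J.hor (k ≫ l) = J.hor k ≫ J.hor l := J.toSq.hor.map_comp k l

theorem sq_comm {x y : VertArrow J.dom.Vert} (α : x ⟶ y) :
    J.hor (J.dom.top α) ≫ J.ver y.arr = J.ver x.arr ≫ J.hor (J.dom.bot α) := by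
  have h := SqHom.comm (J.toSq.sq α)
  have ht := J.toSq.top_sq α
  have hb := J.toSq.bot_sq α
  dsimp only at h ht hb
  rw [ht, hb] at h
  exact h

theorem ver_vid (a : J.dom.Obj) : J.ver (J.dom.vid a) = 𝟙 (J.ob a) := J.toSq.vert_vid a

theorem ver_vcomp {a b c : J.dom.Obj} (f : J.dom.Vert a b) (g : J.dom.Vert b c) :
    J.ver (J.dom.vcomp f g) = J.ver f ≫ J.ver g := J.toSq.vert_vcomp f g

end DoubleOver

/-! ### Lifting operations -/

section Lifting

variable {C : Type u} [Category.{v} C]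

/-- A `(J, K)`-lifting operation: a choice of a diagonal filler for every lifting problem of a
vertical morphism of `J` against a vertical morphism of `K`, natural in the squares of `J` and `K`
and compatible with vertical composition in `J` and in `K`. The two composition laws together are
equivalent to the joint one: the lift for the composites `f' ≫ f` and `g' ≫ g` is the lift of `f`
against `g'` in the square formed by the lift of `f'` against `g' ≫ g` and the lift of `f' ≫ f`
against `g` (take vertical identities for the converse). -/
@[ext]
structure LiftingOperation (J : DoubleOver.{v, u, o₁, h₁, w₁, s₁} C)
    (K : DoubleOver.{v, u, o₂, h₂, w₂, s₂} C) where
  lift : ∀ {a b : J.dom.Obj} (f : J.dom.Vert a b) {c d : K.dom.Obj} (g : K.dom.Vert c d)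
    (u : J.ob a ⟶ K.ob c) (v : J.ob b ⟶ K.ob d), u ≫ K.ver g = J.ver f ≫ v → (J.ob b ⟶ K.ob c)
  fac_left : ∀ {a b : J.dom.Obj} (f : J.dom.Vert a b) {c d : K.dom.Obj} (g : K.dom.Vert c d)
    (u : J.ob a ⟶ K.ob c) (v : J.ob b ⟶ K.ob d) (e : u ≫ K.ver g = J.ver f ≫ v),
    J.ver f ≫ lift f g u v e = u
  fac_right : ∀ {a b : J.dom.Obj} (f : J.dom.Vert a b) {c d : K.dom.Obj} (g : K.dom.Vert c d)
    (u : J.ob a ⟶ K.ob c) (v : J.ob b ⟶ K.ob d) (e : u ≫ K.ver g = J.ver f ≫ v),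
    lift f g u v e ≫ K.ver g = v
  natural : ∀ {x' x : VertArrow J.dom.Vert} (α : x' ⟶ x) {y y' : VertArrow K.dom.Vert}
    (β : y ⟶ y') (u : J.ob x.src ⟶ K.ob y.src) (v : J.ob x.tgt ⟶ K.ob y.tgt)
    (e : u ≫ K.ver y.arr = J.ver x.arr ≫ v),
    lift x'.arr y'.arr (J.hor (J.dom.top α) ≫ u ≫ K.hor (K.dom.top β))
        (J.hor (J.dom.bot α) ≫ v ≫ K.hor (K.dom.bot β))
        (by rw [Category.assoc, Category.assoc, K.sq_comm β, reassoc_of% e,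
          ← Category.assoc, J.sq_comm α, Category.assoc]) =
      J.hor (J.dom.bot α) ≫ lift x.arr y.arr u v e ≫ K.hor (K.dom.top β)
  lift_vcomp_left : ∀ {a b c : J.dom.Obj} (f' : J.dom.Vert a b) (f : J.dom.Vert b c)
    {d e : K.dom.Obj} (g : K.dom.Vert d e) (u : J.ob a ⟶ K.ob d) (v : J.ob c ⟶ K.ob e)
    (i : u ≫ K.ver g = J.ver (J.dom.vcomp f' f) ≫ v),
    lift (J.dom.vcomp f' f) g u v i =
      lift f g (lift f' g u (J.ver f ≫ v) (by rw [i, J.ver_vcomp, Category.assoc])) v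
        (fac_right _ _ _ _ _)
  lift_vcomp_right : ∀ {a b : J.dom.Obj} (f : J.dom.Vert a b) {c d e : K.dom.Obj}
    (g' : K.dom.Vert c d) (g : K.dom.Vert d e) (u : J.ob a ⟶ K.ob c) (v : J.ob b ⟶ K.ob e)
    (i : u ≫ K.ver (K.dom.vcomp g' g) = J.ver f ≫ v),
    lift f (K.dom.vcomp g' g) u v i =
      lift f g' u (lift f g (u ≫ K.ver g') v (by rw [← i, K.ver_vcomp, Category.assoc]))
        (fac_left _ _ _ _ _).symm

/-- A morphism `X ⟶ Y` of `C` together with a lifting operation for it against `K`. -/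
@[ext]
structure LeftLift (K : DoubleOver.{v, u, o₂, h₂, w₂, s₂} C) (X Y : C) where
  arr : X ⟶ Y
  lift : ∀ {c d : K.dom.Obj} (g : K.dom.Vert c d) (u : X ⟶ K.ob c) (v : Y ⟶ K.ob d),
    u ≫ K.ver g = arr ≫ v → (Y ⟶ K.ob c)
  fac_left : ∀ {c d : K.dom.Obj} (g : K.dom.Vert c d) (u : X ⟶ K.ob c) (v : Y ⟶ K.ob d)
    (e : u ≫ K.ver g = arr ≫ v), arr ≫ lift g u v e = u
  fac_right : ∀ {c d : K.dom.Obj} (g : K.dom.Vert c d) (u : X ⟶ K.ob c) (v : Y ⟶ K.ob d)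
    (e : u ≫ K.ver g = arr ≫ v), lift g u v e ≫ K.ver g = v
  natural : ∀ {y y' : VertArrow K.dom.Vert} (β : y ⟶ y') (u : X ⟶ K.ob y.src)
    (v : Y ⟶ K.ob y.tgt) (e : u ≫ K.ver y.arr = arr ≫ v),
    lift y'.arr (u ≫ K.hor (K.dom.top β)) (v ≫ K.hor (K.dom.bot β))
        (by rw [Category.assoc, K.sq_comm β, reassoc_of% e]) =
      lift y.arr u v e ≫ K.hor (K.dom.top β)
  lift_vcomp : ∀ {c d e : K.dom.Obj} (g' : K.dom.Vert c d) (g : K.dom.Vert d e)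
    (u : X ⟶ K.ob c) (v : Y ⟶ K.ob e) (i : u ≫ K.ver (K.dom.vcomp g' g) = arr ≫ v),
    lift (K.dom.vcomp g' g) u v i =
      lift g' u (lift g (u ≫ K.ver g') v (by rw [← i, K.ver_vcomp, Category.assoc]))
        (fac_left _ _ _ _).symm

/-- A morphism `X ⟶ Y` of `C` together with a lifting operation of `J` against it. -/
@[ext]
structure RightLift (J : DoubleOver.{v, u, o₁, h₁, w₁, s₁} C) (X Y : C) where
  arr : X ⟶ Y
  lift : ∀ {a b : J.dom.Obj} (f : J.dom.Vert a b) (u : J.ob a ⟶ X) (v : J.ob b ⟶ Y),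
    u ≫ arr = J.ver f ≫ v → (J.ob b ⟶ X)
  fac_left : ∀ {a b : J.dom.Obj} (f : J.dom.Vert a b) (u : J.ob a ⟶ X) (v : J.ob b ⟶ Y)
    (e : u ≫ arr = J.ver f ≫ v), J.ver f ≫ lift f u v e = u
  fac_right : ∀ {a b : J.dom.Obj} (f : J.dom.Vert a b) (u : J.ob a ⟶ X) (v : J.ob b ⟶ Y)
    (e : u ≫ arr = J.ver f ≫ v), lift f u v e ≫ arr = v
  natural : ∀ {x' x : VertArrow J.dom.Vert} (α : x' ⟶ x) (u : J.ob x.src ⟶ X)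
    (v : J.ob x.tgt ⟶ Y) (e : u ≫ arr = J.ver x.arr ≫ v),
    lift x'.arr (J.hor (J.dom.top α) ≫ u) (J.hor (J.dom.bot α) ≫ v)
        (by rw [Category.assoc, e, ← Category.assoc, J.sq_comm α, Category.assoc]) =
      J.hor (J.dom.bot α) ≫ lift x.arr u v e
  lift_vcomp : ∀ {a b c : J.dom.Obj} (f' : J.dom.Vert a b) (f : J.dom.Vert b c)
    (u : J.ob a ⟶ X) (v : J.ob c ⟶ Y) (i : u ≫ arr = J.ver (J.dom.vcomp f' f) ≫ v),
    lift (J.dom.vcomp f' f) u v i =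
      lift f (lift f' u (J.ver f ≫ v) (by rw [i, J.ver_vcomp, Category.assoc])) v
        (fac_right _ _ _ _)

/-- A square of left-lifting arrows: a commutative square that commutes with the lifting
operations. -/
@[ext]
structure LeftLiftHom (K : DoubleOver.{v, u, o₂, h₂, w₂, s₂} C)
    (x y : VertArrow (LeftLift K)) where
  top : x.src ⟶ y.src
  bot : x.tgt ⟶ y.tgt
  comm : top ≫ y.arr.arr = x.arr.arr ≫ bot
  lift_comm : ∀ {c d : K.dom.Obj} (g : K.dom.Vert c d) (u : y.src ⟶ K.ob c) (v : y.tgt ⟶ K.ob d)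
    (e : u ≫ K.ver g = y.arr.arr ≫ v),
    x.arr.lift g (top ≫ u) (bot ≫ v) (by rw [Category.assoc, e, reassoc_of% comm]) =
      bot ≫ y.arr.lift g u v e

/-- A square of right-lifting arrows: a commutative square that commutes with the lifting
operations. -/
@[ext]
structure RightLiftHom (J : DoubleOver.{v, u, o₁, h₁, w₁, s₁} C)
    (x y : VertArrow (RightLift J)) where
  top : x.src ⟶ y.src
  bot : x.tgt ⟶ y.tgt
  comm : top ≫ y.arr.arr = x.arr.arr ≫ bot
  lift_comm : ∀ {a b : J.dom.Obj} (f : J.dom.Vert a b) (u : J.ob a ⟶ x.src) (v : J.ob b ⟶ x.tgt)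
    (e : u ≫ x.arr.arr = J.ver f ≫ v),
    y.arr.lift f (u ≫ top) (v ≫ bot) (by rw [Category.assoc, comm, reassoc_of% e]) =
      x.arr.lift f u v e ≫ top

instance leftLiftCategory (K : DoubleOver.{v, u, o₂, h₂, w₂, s₂} C) :
    Category.{v} (VertArrow (LeftLift K)) where
  Hom x y := LeftLiftHom K x y
  id x := ⟨𝟙 _, 𝟙 _, by simp, by intros; simp⟩
  comp α β := ⟨α.top ≫ β.top, α.bot ≫ β.bot,
    by rw [Category.assoc, β.comm, ← Category.assoc, α.comm, Category.assoc], by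
      intro c d g u v e
      have hβ := β.lift_comm g u v e
      have hα := α.lift_comm g (β.top ≫ u) (β.bot ≫ v)
        (by rw [Category.assoc, e, reassoc_of% β.comm])
      simp only [Category.assoc]
      rw [hα, hβ]⟩
  id_comp α := by apply LeftLiftHom.ext <;> simp
  comp_id α := by apply LeftLiftHom.ext <;> simp
  assoc α β γ := by apply LeftLiftHom.ext <;> simp

instance rightLiftCategory (J : DoubleOver.{v, u, o₁, h₁, w₁, s₁} C) :
    Category.{v} (VertArrow (RightLift J)) where
  Hom x y := RightLiftHom J x y
  id x := ⟨𝟙 _, 𝟙 _, by simp, by intros; simp⟩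
  comp α β := ⟨α.top ≫ β.top, α.bot ≫ β.bot,
    by rw [Category.assoc, β.comm, ← Category.assoc, α.comm, Category.assoc], by
      intro a b f u v e
      have hα := α.lift_comm f u v e
      have hβ := β.lift_comm f (u ≫ α.top) (v ≫ α.bot)
        (by rw [Category.assoc, α.comm, reassoc_of% e])
      simp only [← Category.assoc]
      rw [hβ, hα]⟩
  id_comp α := by apply RightLiftHom.ext <;> simp
  comp_id α := by apply RightLiftHom.ext <;> simp
  assoc α β γ := by apply RightLiftHom.ext <;> simp

theorem LeftLift.ext_lift {K : DoubleOver.{v, u, o₂, h₂, w₂, s₂} C} {X Y : C}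
    {f f' : LeftLift K X Y} (h : f.arr = f'.arr)
    (hl : ∀ {c d : K.dom.Obj} (g : K.dom.Vert c d) (u : X ⟶ K.ob c) (v : Y ⟶ K.ob d)
      (e : u ≫ K.ver g = f.arr ≫ v) (e' : u ≫ K.ver g = f'.arr ≫ v),
      f.lift g u v e = f'.lift g u v e') : f = f' := by
  obtain ⟨a, l, _, _, _, _⟩ := f
  obtain ⟨a', l', _, _, _, _⟩ := f'
  dsimp only at h hl
  subst h
  obtain rfl : @l = @l' := by
    funext c d g u v e
    exact hl g u v e e
  rfl

theorem RightLift.ext_lift {J : DoubleOver.{v, u, o₁, h₁, w₁, s₁} C} {X Y : C}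
    {f f' : RightLift J X Y} (h : f.arr = f'.arr)
    (hl : ∀ {a b : J.dom.Obj} (g : J.dom.Vert a b) (u : J.ob a ⟶ X) (v : J.ob b ⟶ Y)
      (e : u ≫ f.arr = J.ver g ≫ v) (e' : u ≫ f'.arr = J.ver g ≫ v),
      f.lift g u v e = f'.lift g u v e') : f = f' := by
  obtain ⟨a, l, _, _, _, _⟩ := f
  obtain ⟨a', l', _, _, _, _⟩ := f'
  dsimp only at h hl
  subst h
  obtain rfl : @l = @l' := by
    funext c d g u v e
    exact hl g u v e e
  rfl

theorem LeftLiftHom.heq {K : DoubleOver.{v, u, o₂, h₂, w₂, s₂} C} {X Y X' Y' : C}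
    {f₁ f₂ : LeftLift K X Y} {g₁ g₂ : LeftLift K X' Y'} (hf : f₁ = f₂) (hg : g₁ = g₂)
    (α₁ : LeftLiftHom K ⟨X, Y, f₁⟩ ⟨X', Y', g₁⟩) (α₂ : LeftLiftHom K ⟨X, Y, f₂⟩ ⟨X', Y', g₂⟩)
    (ht : α₁.top = α₂.top) (hb : α₁.bot = α₂.bot) : HEq α₁ α₂ := by
  subst hf hg
  exact heq_of_eq (LeftLiftHom.ext ht hb)

theorem RightLiftHom.heq {J : DoubleOver.{v, u, o₁, h₁, w₁, s₁} C} {X Y X' Y' : C}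
    {f₁ f₂ : RightLift J X Y} {g₁ g₂ : RightLift J X' Y'} (hf : f₁ = f₂) (hg : g₁ = g₂)
    (α₁ : RightLiftHom J ⟨X, Y, f₁⟩ ⟨X', Y', g₁⟩) (α₂ : RightLiftHom J ⟨X, Y, f₂⟩ ⟨X', Y', g₂⟩)
    (ht : α₁.top = α₂.top) (hb : α₁.bot = α₂.bot) : HEq α₁ α₂ := by
  subst hf hg
  exact heq_of_eq (RightLiftHom.ext ht hb)

/-- The identity of `X` with its only lifting operation. -/
@[reducible]
def LeftLift.vid (K : DoubleOver.{v, u, o₂, h₂, w₂, s₂} C) (X : C) : LeftLift K X X where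
  arr := 𝟙 X
  lift _ u _ _ := u
  fac_left _ _ _ _ := Category.id_comp _
  fac_right _ _ _ e := by rw [e, Category.id_comp]
  natural _ _ _ _ := rfl
  lift_vcomp _ _ _ _ _ := rfl

/-- Composition of left-lifting arrows. -/
@[reducible]
def LeftLift.vcomp {K : DoubleOver.{v, u, o₂, h₂, w₂, s₂} C} {X Y Z : C} (f' : LeftLift K X Y)
    (f : LeftLift K Y Z) : LeftLift K X Z where
  arr := f'.arr ≫ f.arr
  lift g u v e := f.lift g (f'.lift g u (f.arr ≫ v) (by rw [e, Category.assoc])) v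
    (f'.fac_right _ _ _ _)
  fac_left g u v e := by rw [Category.assoc, f.fac_left, f'.fac_left]
  fac_right g u v e := f.fac_right _ _ _ _
  natural {y y'} β u v e := by
    rw [← f.natural β]
    congr 1
    rw [← f'.natural β]
    congr 1
    rw [Category.assoc]
  lift_vcomp g' g u v i := by
    rw [f.lift_vcomp]
    congr 1
    · rw [f'.lift_vcomp]
      congr 1
      rw [f.fac_left]
    · congr 1
      rw [f'.lift_vcomp, f'.fac_right]

/-- The identity of `X` with its only lifting operation. -/
@[reducible]
def RightLift.vid (J : DoubleOver.{v, u, o₁, h₁, w₁, s₁} C) (X : C) : RightLift J X X where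
  arr := 𝟙 X
  lift _ _ v _ := v
  fac_left _ _ _ e := by rw [← e, Category.comp_id]
  fac_right _ _ _ _ := Category.comp_id _
  natural _ _ _ _ := rfl
  lift_vcomp _ _ _ _ _ := rfl

/-- Composition of right-lifting arrows. -/
@[reducible]
def RightLift.vcomp {J : DoubleOver.{v, u, o₁, h₁, w₁, s₁} C} {X Y Z : C} (g' : RightLift J X Y)
    (g : RightLift J Y Z) : RightLift J X Z where
  arr := g'.arr ≫ g.arr
  lift f u v e := g'.lift f u (g.lift f (u ≫ g'.arr) v (by rw [← e, Category.assoc]))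
    (g.fac_left _ _ _ _).symm
  fac_left f u v e := g'.fac_left _ _ _ _
  fac_right f u v e := by rw [← Category.assoc, g'.fac_right, g.fac_right]
  natural {x' x} α u v e := by
    rw [← g'.natural α]
    congr 1
    rw [← g.natural α]
    congr 1
    rw [Category.assoc]
  lift_vcomp f' f u v i := by
    rw [g'.lift_vcomp]
    congr 1
    · congr 1
      rw [g.lift_vcomp, g.fac_left]
    · rw [g.lift_vcomp]
      congr 1
      rw [g'.fac_right]

/-- Vertical composition of squares of left-lifting arrows. -/
@[reducible]
def LeftLiftHom.vcomp {K : DoubleOver.{v, u, o₂, h₂, w₂, s₂} C} {X Y Z X' Y' Z' : C}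
    {f : LeftLift K X Y} {g : LeftLift K Y Z} {f' : LeftLift K X' Y'} {g' : LeftLift K Y' Z'}
    (α : LeftLiftHom K ⟨X, Y, f⟩ ⟨X', Y', f'⟩) (β : LeftLiftHom K ⟨Y, Z, g⟩ ⟨Y', Z', g'⟩)
    (e : α.bot = β.top) : LeftLiftHom K ⟨X, Z, f.vcomp g⟩ ⟨X', Z', f'.vcomp g'⟩ where
  top := α.top
  bot := β.bot
  comm := by
    have h₁ := α.comm
    have h₂ := β.comm
    dsimp only at h₁ h₂ e ⊢
    rw [← Category.assoc, h₁, Category.assoc, e, h₂, Category.assoc]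
  lift_comm k u v i := by
    have h₁ := α.lift_comm k u (g'.arr ≫ v) (by rw [i, Category.assoc])
    have hc := β.comm
    have h₂ := β.lift_comm k
      (f'.lift k u (g'.arr ≫ v) (by rw [i, Category.assoc])) v (f'.fac_right _ _ _ _)
    dsimp only at h₁ h₂ hc e ⊢
    rw [← h₂]
    congr 1
    refine Eq.trans ?_ (h₁.trans (congrArg (fun t => t ≫ _) e))
    congr 1
    rw [e, reassoc_of% hc]

/-- Vertical composition of squares of right-lifting arrows. -/
@[reducible]
def RightLiftHom.vcomp {J : DoubleOver.{v, u, o₁, h₁, w₁, s₁} C} {X Y Z X' Y' Z' : C}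
    {f : RightLift J X Y} {g : RightLift J Y Z} {f' : RightLift J X' Y'} {g' : RightLift J Y' Z'}
    (α : RightLiftHom J ⟨X, Y, f⟩ ⟨X', Y', f'⟩) (β : RightLiftHom J ⟨Y, Z, g⟩ ⟨Y', Z', g'⟩)
    (e : α.bot = β.top) : RightLiftHom J ⟨X, Z, f.vcomp g⟩ ⟨X', Z', f'.vcomp g'⟩ where
  top := α.top
  bot := β.bot
  comm := by
    have h₁ := α.comm
    have h₂ := β.comm
    dsimp only at h₁ h₂ e ⊢
    rw [← Category.assoc, h₁, Category.assoc, e, h₂, Category.assoc]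
  lift_comm k u v i := by
    have h₂ := β.lift_comm k (u ≫ f.arr) v (by rw [← i, Category.assoc])
    have hc := α.comm
    have h₁ := α.lift_comm k u
      (g.lift k (u ≫ f.arr) v (by rw [← i, Category.assoc])) (g.fac_left _ _ _ _).symm
    dsimp only at h₁ h₂ hc e ⊢
    rw [← h₁]
    congr 1
    refine Eq.trans ?_ (h₂.trans (congrArg (fun t => _ ≫ t) e.symm))
    congr 1
    rw [Category.assoc, Category.assoc, hc, e]

/-- The double category, over the squares of `C`, of morphisms of `C` equipped with a lifting
operation against `K`. -/
@[reducible]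
def leftDual (K : DoubleOver.{v, u, o₂, h₂, w₂, s₂} C) :
    DoubleOver.{v, u, u, v, max v o₂ w₂, v} C where
  dom :=
    { Obj := C
      Vert := LeftLift K
      top := fun α => LeftLiftHom.top α
      top_id := fun _ => rfl
      top_comp := fun _ _ => rfl
      bot := fun α => LeftLiftHom.bot α
      bot_id := fun _ => rfl
      bot_comp := fun _ _ => rfl
      vid := LeftLift.vid K
      vidSq := fun k => LeftLiftHom.mk k k (by simp) (fun _ _ _ _ => rfl)
      vidSq_id := fun _ => rfl
      vidSq_comp := fun _ _ => rfl
      top_vidSq := fun _ => rfl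
      bot_vidSq := fun _ => rfl
      vcomp := LeftLift.vcomp
      vcompSq := fun α β e => LeftLiftHom.vcomp α β e
      top_vcompSq := fun _ _ _ => rfl
      bot_vcompSq := fun _ _ _ => rfl
      vcompSq_id := fun _ _ => rfl
      vcompSq_comp := fun _ _ _ _ _ _ => rfl
      vid_vcomp := fun f => LeftLift.ext_lift (Category.id_comp _) (fun _ _ _ _ _ => rfl)
      vcomp_vid := fun f => LeftLift.ext_lift (Category.comp_id _) (fun _ _ _ _ _ => by
        dsimp only
        congr 1
        rw [Category.id_comp])
      vcomp_assoc := fun f g k => LeftLift.ext_lift (Category.assoc _ _ _) (fun _ _ _ _ _ => by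
        dsimp only
        congr 2
        congr 1
        rw [Category.assoc])
      vidSq_vcompSq := fun _ => by
        refine LeftLiftHom.heq ?_ ?_ _ _ ?_ ?_
        · exact LeftLift.ext_lift (Category.id_comp _) (fun _ _ _ _ _ => rfl)
        · exact LeftLift.ext_lift (Category.id_comp _) (fun _ _ _ _ _ => rfl)
        · rfl
        · rfl
      vcompSq_vidSq := fun _ => LeftLiftHom.heq
        (LeftLift.ext_lift (Category.comp_id _) (fun _ _ _ _ _ => by
          dsimp only
          congr 1
          rw [Category.id_comp]))
        (LeftLift.ext_lift (Category.comp_id _) (fun _ _ _ _ _ => by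
          dsimp only
          congr 1
          rw [Category.id_comp])) _ _ rfl rfl
      vcompSq_assoc := fun _ _ _ _ _ => LeftLiftHom.heq
        (LeftLift.ext_lift (Category.assoc _ _ _) (fun _ _ _ _ _ => by
          dsimp only
          congr 2
          congr 1
          rw [Category.assoc]))
        (LeftLift.ext_lift (Category.assoc _ _ _) (fun _ _ _ _ _ => by
          dsimp only
          congr 2
          congr 1
          rw [Category.assoc])) _ _ rfl rfl }
  toSq :=
    { hor := 𝟭 C
      vert := fun f => f.arr
      sq := fun α => SqHom.mk (LeftLiftHom.top α) (LeftLiftHom.bot α) (LeftLiftHom.comm α)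
      sq_id := fun _ => rfl
      sq_comp := fun _ _ => rfl
      top_sq := fun _ => rfl
      bot_sq := fun _ => rfl
      vert_vid := fun _ => rfl
      vert_vcomp := fun _ _ => rfl
      sq_vidSq := fun _ => HEq.rfl
      sq_vcompSq := fun _ _ _ => HEq.rfl }

/-- The double category, over the squares of `C`, of morphisms of `C` equipped with a lifting
operation of `J` against them. -/
@[reducible]
def rightDual (J : DoubleOver.{v, u, o₁, h₁, w₁, s₁} C) :
    DoubleOver.{v, u, u, v, max v o₁ w₁, v} C where
  dom :=
    { Obj := C
      Vert := RightLift J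
      top := fun α => RightLiftHom.top α
      top_id := fun _ => rfl
      top_comp := fun _ _ => rfl
      bot := fun α => RightLiftHom.bot α
      bot_id := fun _ => rfl
      bot_comp := fun _ _ => rfl
      vid := RightLift.vid J
      vidSq := fun k => RightLiftHom.mk k k (by simp) (fun _ _ _ _ => rfl)
      vidSq_id := fun _ => rfl
      vidSq_comp := fun _ _ => rfl
      top_vidSq := fun _ => rfl
      bot_vidSq := fun _ => rfl
      vcomp := RightLift.vcomp
      vcompSq := fun α β e => RightLiftHom.vcomp α β e
      top_vcompSq := fun _ _ _ => rfl
      bot_vcompSq := fun _ _ _ => rfl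
      vcompSq_id := fun _ _ => rfl
      vcompSq_comp := fun _ _ _ _ _ _ => rfl
      vid_vcomp := fun f => RightLift.ext_lift (Category.id_comp _) (fun _ _ _ _ _ => by
        dsimp only
        congr 1
        rw [Category.comp_id])
      vcomp_vid := fun f => RightLift.ext_lift (Category.comp_id _) (fun _ _ _ _ _ => rfl)
      vcomp_assoc := fun f g k => RightLift.ext_lift (Category.assoc _ _ _) (fun _ _ _ _ _ => by
        dsimp only
        congr 2
        congr 1
        rw [Category.assoc])
      vidSq_vcompSq := fun _ => RightLiftHom.heq
        (RightLift.ext_lift (Category.id_comp _) (fun _ _ _ _ _ => by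
          dsimp only
          congr 1
          rw [Category.comp_id]))
        (RightLift.ext_lift (Category.id_comp _) (fun _ _ _ _ _ => by
          dsimp only
          congr 1
          rw [Category.comp_id])) _ _ rfl rfl
      vcompSq_vidSq := fun _ => by
        refine RightLiftHom.heq ?_ ?_ _ _ ?_ ?_
        · exact RightLift.ext_lift (Category.comp_id _) (fun _ _ _ _ _ => rfl)
        · exact RightLift.ext_lift (Category.comp_id _) (fun _ _ _ _ _ => rfl)
        · rfl
        · rfl
      vcompSq_assoc := fun _ _ _ _ _ => RightLiftHom.heq
        (RightLift.ext_lift (Category.assoc _ _ _) (fun _ _ _ _ _ => by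
          dsimp only
          congr 2
          congr 1
          rw [Category.assoc]))
        (RightLift.ext_lift (Category.assoc _ _ _) (fun _ _ _ _ _ => by
          dsimp only
          congr 2
          congr 1
          rw [Category.assoc])) _ _ rfl rfl }
  toSq :=
    { hor := 𝟭 C
      vert := fun f => f.arr
      sq := fun α => SqHom.mk (RightLiftHom.top α) (RightLiftHom.bot α) (RightLiftHom.comm α)
      sq_id := fun _ => rfl
      sq_comp := fun _ _ => rfl
      top_sq := fun _ => rfl
      bot_sq := fun _ => rfl
      vert_vid := fun _ => rfl
      vert_vcomp := fun _ _ => rfl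
      sq_vidSq := fun _ => HEq.rfl
      sq_vcompSq := fun _ _ _ => HEq.rfl }

end Lifting

/-! ### Closed lifting structures -/

namespace LiftingOperation

variable {C : Type u} [Category.{v} C] {J : DoubleOver.{v, u, o₁, h₁, w₁, s₁} C}
  {K : DoubleOver.{v, u, o₂, h₂, w₂, s₂} C} (φ : LiftingOperation J K)

/-- The lifting operation of a vertical morphism of `J` against `K`. -/
@[reducible]
def leftLift {a b : J.dom.Obj} (f : J.dom.Vert a b) : LeftLift K (J.ob a) (J.ob b) where
  arr := J.ver f
  lift g u v e := φ.lift f g u v e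
  fac_left g u v e := φ.fac_left f g u v e
  fac_right g u v e := φ.fac_right f g u v e
  natural {y y'} β u v e := by
    have h := φ.natural (𝟙 (⟨a, b, f⟩ : VertArrow J.dom.Vert)) β u v e
    simp only [J.dom.top_id, J.dom.bot_id, J.hor_id, Category.id_comp] at h
    exact h
  lift_vcomp g' g u v i := φ.lift_vcomp_right f g' g u v i

/-- The lifting operation of `J` against a vertical morphism of `K`. -/
@[reducible]
def rightLift {c d : K.dom.Obj} (g : K.dom.Vert c d) : RightLift J (K.ob c) (K.ob d) where
  arr := K.ver g
  lift f u v e := φ.lift f g u v e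
  fac_left f u v e := φ.fac_left f g u v e
  fac_right f u v e := φ.fac_right f g u v e
  natural {x' x} α u v e := by
    have h := φ.natural α (𝟙 (⟨c, d, g⟩ : VertArrow K.dom.Vert)) u v e
    simp only [K.dom.top_id, K.dom.bot_id, K.hor_id, Category.comp_id] at h
    exact h
  lift_vcomp f' f u v i := φ.lift_vcomp_left f' f g u v i

/-- The double functor from `J` to the left dual of `K` induced by a lifting operation. -/
def toLeftDual : DoubleFunctor J.dom (leftDual K).dom where
  hor := J.toSq.hor
  vert f := φ.leftLift f
  sq {x y} α := LeftLiftHom.mk (J.hor (J.dom.top α)) (J.hor (J.dom.bot α)) (J.sq_comm α)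
    (fun {c d} g u v e => by
      have h := φ.natural α (𝟙 (⟨c, d, g⟩ : VertArrow K.dom.Vert)) u v e
      simp only [K.dom.top_id, K.dom.bot_id, K.hor_id, Category.comp_id] at h
      exact h)
  sq_id x := LeftLiftHom.ext ((congrArg J.toSq.hor.map (J.dom.top_id x)).trans (J.toSq.hor.map_id _))
    ((congrArg J.toSq.hor.map (J.dom.bot_id x)).trans (J.toSq.hor.map_id _))
  sq_comp α β := LeftLiftHom.ext ((congrArg J.toSq.hor.map (J.dom.top_comp α β)).trans (J.toSq.hor.map_comp _ _))
    ((congrArg J.toSq.hor.map (J.dom.bot_comp α β)).trans (J.toSq.hor.map_comp _ _))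
  top_sq _ := rfl
  bot_sq _ := rfl
  vert_vid a := LeftLift.ext_lift (J.ver_vid a) (fun g u v e e' => by
    have h := φ.fac_left (J.dom.vid a) g u v e
    rw [J.ver_vid, Category.id_comp] at h
    exact h)
  vert_vcomp f g := LeftLift.ext_lift (J.ver_vcomp f g)
    (fun k u v e _ => φ.lift_vcomp_left f g k u v e)
  sq_vidSq k := by
    refine LeftLiftHom.heq ?_ ?_ _ _ ?_ ?_
    · exact LeftLift.ext_lift (J.ver_vid _) (fun g u v e e' => by
        have h := φ.fac_left (J.dom.vid _) g u v e
        rw [J.ver_vid, Category.id_comp] at h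
        exact h)
    · exact LeftLift.ext_lift (J.ver_vid _) (fun g u v e e' => by
        have h := φ.fac_left (J.dom.vid _) g u v e
        rw [J.ver_vid, Category.id_comp] at h
        exact h)
    · exact congrArg J.toSq.hor.map (J.dom.top_vidSq k)
    · exact congrArg J.toSq.hor.map (J.dom.bot_vidSq k)
  sq_vcompSq α β e := by
    refine LeftLiftHom.heq ?_ ?_ _ _ ?_ ?_
    · exact LeftLift.ext_lift (J.ver_vcomp _ _)
        (fun k u v e _ => φ.lift_vcomp_left _ _ k u v e)
    · exact LeftLift.ext_lift (J.ver_vcomp _ _)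
        (fun k u v e _ => φ.lift_vcomp_left _ _ k u v e)
    · exact congrArg J.toSq.hor.map (J.dom.top_vcompSq α β e)
    · exact congrArg J.toSq.hor.map (J.dom.bot_vcompSq α β e)

/-- The double functor from `K` to the right dual of `J` induced by a lifting operation. -/
def toRightDual : DoubleFunctor K.dom (rightDual J).dom where
  hor := K.toSq.hor
  vert g := φ.rightLift g
  sq {y y'} β := RightLiftHom.mk (K.hor (K.dom.top β)) (K.hor (K.dom.bot β)) (K.sq_comm β)
    (fun {a b} f u v e => by
      have h := φ.natural (𝟙 (⟨a, b, f⟩ : VertArrow J.dom.Vert)) β u v e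
      simp only [J.dom.top_id, J.dom.bot_id, J.hor_id, Category.id_comp] at h
      exact h)
  sq_id x := RightLiftHom.ext ((congrArg K.toSq.hor.map (K.dom.top_id x)).trans (K.toSq.hor.map_id _))
    ((congrArg K.toSq.hor.map (K.dom.bot_id x)).trans (K.toSq.hor.map_id _))
  sq_comp α β := RightLiftHom.ext ((congrArg K.toSq.hor.map (K.dom.top_comp α β)).trans (K.toSq.hor.map_comp _ _))
    ((congrArg K.toSq.hor.map (K.dom.bot_comp α β)).trans (K.toSq.hor.map_comp _ _))
  top_sq _ := rfl
  bot_sq _ := rfl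
  vert_vid c := RightLift.ext_lift (K.ver_vid c) (fun f u v e e' => by
    have h := φ.fac_right f (K.dom.vid c) u v e
    rw [K.ver_vid, Category.comp_id] at h
    exact h)
  vert_vcomp f g := RightLift.ext_lift (K.ver_vcomp f g)
    (fun k u v e _ => φ.lift_vcomp_right k f g u v e)
  sq_vidSq k := by
    refine RightLiftHom.heq ?_ ?_ _ _ ?_ ?_
    · exact RightLift.ext_lift (K.ver_vid _) (fun f u v e e' => by
        have h := φ.fac_right f (K.dom.vid _) u v e
        rw [K.ver_vid, Category.comp_id] at h
        exact h)
    · exact RightLift.ext_lift (K.ver_vid _) (fun f u v e e' => by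
        have h := φ.fac_right f (K.dom.vid _) u v e
        rw [K.ver_vid, Category.comp_id] at h
        exact h)
    · exact congrArg K.toSq.hor.map (K.dom.top_vidSq k)
    · exact congrArg K.toSq.hor.map (K.dom.bot_vidSq k)
  sq_vcompSq α β e := by
    refine RightLiftHom.heq ?_ ?_ _ _ ?_ ?_
    · exact RightLift.ext_lift (K.ver_vcomp _ _)
        (fun k u v e _ => φ.lift_vcomp_right k _ _ u v e)
    · exact RightLift.ext_lift (K.ver_vcomp _ _)
        (fun k u v e _ => φ.lift_vcomp_right k _ _ u v e)
    · exact congrArg K.toSq.hor.map (K.dom.top_vcompSq α β e)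
    · exact congrArg K.toSq.hor.map (K.dom.bot_vcompSq α β e)

/-- The lifting structure `(J, φ, K)` is closed if both induced double functors, from `J` to the
left dual of `K` and from `K` to the right dual of `J`, are invertible. -/
def IsClosed : Prop :=
  φ.toLeftDual.IsInvertible ∧ φ.toRightDual.IsInvertible

end LiftingOperation

/-! ### Slicing -/

section Slice

variable {C : Type u} [Category.{v} C] (J : DoubleOver.{v, u, o, h, w, s} C) (A : C)

/-- An object of the slice `J / A`: an object of `J` whose underlying object of `C` lies over
`A`. -/
structure SliceObj where
  pt : J.dom.Obj
  ext : J.ob pt ⟶ A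

variable {J A}

/-- A horizontal morphism of the slice `J / A`. -/
@[ext]
structure SliceHor (x y : SliceObj J A) where
  hom : x.pt ⟶ y.pt
  isOver : J.hor hom ≫ y.ext = x.ext

/-- A vertical morphism of the slice `J / A`. -/
@[ext]
structure SliceVert (x y : SliceObj J A) where
  vert : J.dom.Vert x.pt y.pt
  isOver : J.ver vert ≫ y.ext = x.ext

/-- A square of the slice `J / A`. -/
@[ext]
structure SliceSq (x y : VertArrow (SliceVert (J := J) (A := A))) where
  sq : (⟨x.src.pt, x.tgt.pt, x.arr.vert⟩ : VertArrow J.dom.Vert) ⟶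
    ⟨y.src.pt, y.tgt.pt, y.arr.vert⟩
  top_over : J.hor (J.dom.top sq) ≫ y.src.ext = x.src.ext
  bot_over : J.hor (J.dom.bot sq) ≫ y.tgt.ext = x.tgt.ext

instance sliceHorCategory : Category.{h} (SliceObj J A) where
  Hom x y := SliceHor x y
  id x := ⟨𝟙 _, by rw [J.hor_id, Category.id_comp]⟩
  comp k l := ⟨k.hom ≫ l.hom, by rw [J.hor_comp, Category.assoc, l.isOver, k.isOver]⟩
  id_comp k := SliceHor.ext (Category.id_comp _)
  comp_id k := SliceHor.ext (Category.comp_id _)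
  assoc k l m := SliceHor.ext (Category.assoc _ _ _)

instance sliceSqCategory : Category.{s} (VertArrow (SliceVert (J := J) (A := A))) where
  Hom x y := SliceSq x y
  id x := ⟨𝟙 _, by rw [J.dom.top_id, J.hor_id, Category.id_comp],
    by rw [J.dom.bot_id, J.hor_id, Category.id_comp]⟩
  comp α β := ⟨α.sq ≫ β.sq,
    by rw [J.dom.top_comp, J.hor_comp, Category.assoc, β.top_over, α.top_over],
    by rw [J.dom.bot_comp, J.hor_comp, Category.assoc, β.bot_over, α.bot_over]⟩
  id_comp α := SliceSq.ext (Category.id_comp _)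
  comp_id α := SliceSq.ext (Category.comp_id _)
  assoc α β γ := SliceSq.ext (Category.assoc _ _ _)

theorem SliceSq.heq {x y x' y' : SliceObj J A} {f₁ f₂ : SliceVert x y} {g₁ g₂ : SliceVert x' y'}
    (hf : f₁.vert = f₂.vert) (hg : g₁.vert = g₂.vert) (α₁ : SliceSq ⟨x, y, f₁⟩ ⟨x', y', g₁⟩)
    (α₂ : SliceSq ⟨x, y, f₂⟩ ⟨x', y', g₂⟩) (h : HEq α₁.sq α₂.sq) : HEq α₁ α₂ := by
  obtain rfl : f₁ = f₂ := SliceVert.ext hf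
  obtain rfl : g₁ = g₂ := SliceVert.ext hg
  exact heq_of_eq (SliceSq.ext (eq_of_heq h))

/-- Vertical identities of the slice. -/
@[reducible]
def SliceVert.vid (x : SliceObj J A) : SliceVert x x where
  vert := J.dom.vid x.pt
  isOver := by rw [J.ver_vid, Category.id_comp]

/-- Vertical composition in the slice. -/
@[reducible]
def SliceVert.vcomp {x y z : SliceObj J A} (f : SliceVert x y) (g : SliceVert y z) :
    SliceVert x z where
  vert := J.dom.vcomp f.vert g.vert
  isOver := by rw [J.ver_vcomp, Category.assoc, g.isOver, f.isOver]

/-- Vertical identity squares of the slice. -/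
@[reducible]
def SliceSq.vidSq {x y : SliceObj J A} (k : SliceHor x y) :
    SliceSq ⟨x, x, SliceVert.vid x⟩ ⟨y, y, SliceVert.vid y⟩ where
  sq := J.dom.vidSq k.hom
  top_over := by rw [J.dom.top_vidSq]; exact k.isOver
  bot_over := by rw [J.dom.bot_vidSq]; exact k.isOver

/-- Vertical composition of squares of the slice. -/
@[reducible]
def SliceSq.vcompSq {x y z x' y' z' : SliceObj J A} {f : SliceVert x y} {g : SliceVert y z}
    {f' : SliceVert x' y'} {g' : SliceVert y' z'} (α : SliceSq ⟨x, y, f⟩ ⟨x', y', f'⟩)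
    (β : SliceSq ⟨y, z, g⟩ ⟨y', z', g'⟩) (e : J.dom.bot α.sq = J.dom.top β.sq) :
    SliceSq ⟨x, z, f.vcomp g⟩ ⟨x', z', f'.vcomp g'⟩ where
  sq := J.dom.vcompSq α.sq β.sq e
  top_over := by rw [J.dom.top_vcompSq]; exact α.top_over
  bot_over := by rw [J.dom.bot_vcompSq]; exact β.bot_over

variable (J A)

/-- The slice `J / A`, over the squares of `C / A`: the pullback of `J` along the double functor
from the squares of `C / A` to the squares of `C`, formed levelwise. Since an object of `C / A` is
its domain together with a map to `A`, an element of the pullback is an element of `J` whose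
underlying data in `C` are equipped with compatible maps to `A`. -/
@[reducible]
def DoubleOver.slice : DoubleOver.{v, max u v, max o v, h, w, s} (Over A) where
  dom :=
    { Obj := SliceObj J A
      Vert := SliceVert
      top := fun α => SliceHor.mk (J.dom.top (SliceSq.sq α)) (SliceSq.top_over α)
      top_id := fun _ => SliceHor.ext (J.dom.top_id _)
      top_comp := fun _ _ => SliceHor.ext (J.dom.top_comp _ _)
      bot := fun α => SliceHor.mk (J.dom.bot (SliceSq.sq α)) (SliceSq.bot_over α)
      bot_id := fun _ => SliceHor.ext (J.dom.bot_id _)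
      bot_comp := fun _ _ => SliceHor.ext (J.dom.bot_comp _ _)
      vid := SliceVert.vid
      vidSq := fun k => SliceSq.vidSq k
      vidSq_id := fun _ => SliceSq.ext (J.dom.vidSq_id _)
      vidSq_comp := fun _ _ => SliceSq.ext (J.dom.vidSq_comp _ _)
      top_vidSq := fun _ => SliceHor.ext (J.dom.top_vidSq _)
      bot_vidSq := fun _ => SliceHor.ext (J.dom.bot_vidSq _)
      vcomp := SliceVert.vcomp
      vcompSq := fun α β e => SliceSq.vcompSq α β (congrArg SliceHor.hom e)
      top_vcompSq := fun _ _ _ => SliceHor.ext (J.dom.top_vcompSq _ _ _)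
      bot_vcompSq := fun _ _ _ => SliceHor.ext (J.dom.bot_vcompSq _ _ _)
      vcompSq_id := fun _ _ => SliceSq.ext (J.dom.vcompSq_id _ _)
      vcompSq_comp := fun _ _ _ _ _ _ => SliceSq.ext (J.dom.vcompSq_comp _ _ _ _ _ _)
      vid_vcomp := fun _ => SliceVert.ext (J.dom.vid_vcomp _)
      vcomp_vid := fun _ => SliceVert.ext (J.dom.vcomp_vid _)
      vcomp_assoc := fun _ _ _ => SliceVert.ext (J.dom.vcomp_assoc _ _ _)
      vidSq_vcompSq := fun _ => SliceSq.heq (J.dom.vid_vcomp _) (J.dom.vid_vcomp _) _ _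
        (J.dom.vidSq_vcompSq _)
      vcompSq_vidSq := fun _ => SliceSq.heq (J.dom.vcomp_vid _) (J.dom.vcomp_vid _) _ _
        (J.dom.vcompSq_vidSq _)
      vcompSq_assoc := fun _ _ _ _ _ => SliceSq.heq (J.dom.vcomp_assoc _ _ _)
        (J.dom.vcomp_assoc _ _ _) _ _ (J.dom.vcompSq_assoc _ _ _ _ _) }
  toSq :=
    { hor :=
        { obj := fun x => Over.mk x.ext
          map := fun {x y} k => Over.homMk (U := Over.mk x.ext) (V := Over.mk y.ext)
            (J.hor (SliceHor.hom k)) (SliceHor.isOver k)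
          map_id := fun _ => Over.OverMorphism.ext (J.toSq.hor.map_id _)
          map_comp := fun _ _ => Over.OverMorphism.ext (J.toSq.hor.map_comp _ _) }
      vert := fun {x y} f => Over.homMk (U := Over.mk x.ext) (V := Over.mk y.ext)
        (J.ver f.vert) f.isOver
      sq := fun {x y} α => SqHom.mk
        (Over.homMk (U := Over.mk x.src.ext) (V := Over.mk y.src.ext)
          (J.hor (J.dom.top (SliceSq.sq α))) (SliceSq.top_over α))
        (Over.homMk (U := Over.mk x.tgt.ext) (V := Over.mk y.tgt.ext)
          (J.hor (J.dom.bot (SliceSq.sq α))) (SliceSq.bot_over α))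
        (Over.OverMorphism.ext (J.sq_comm (SliceSq.sq α)))
      sq_id := fun _ => SqHom.ext
        (Over.OverMorphism.ext ((congrArg J.toSq.hor.map (J.dom.top_id _)).trans
          (J.toSq.hor.map_id _)))
        (Over.OverMorphism.ext ((congrArg J.toSq.hor.map (J.dom.bot_id _)).trans
          (J.toSq.hor.map_id _)))
      sq_comp := fun _ _ => SqHom.ext
        (Over.OverMorphism.ext ((congrArg J.toSq.hor.map (J.dom.top_comp _ _)).trans
          (J.toSq.hor.map_comp _ _)))
        (Over.OverMorphism.ext ((congrArg J.toSq.hor.map (J.dom.bot_comp _ _)).trans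
          (J.toSq.hor.map_comp _ _)))
      top_sq := fun _ => rfl
      bot_sq := fun _ => rfl
      vert_vid := fun x => Over.OverMorphism.ext (J.ver_vid x.pt)
      vert_vcomp := fun f g => Over.OverMorphism.ext (J.ver_vcomp f.vert g.vert)
      sq_vidSq := fun _ => SqHom.heq (Over.OverMorphism.ext (J.ver_vid _))
        (Over.OverMorphism.ext (J.ver_vid _)) _ _
        (Over.OverMorphism.ext (congrArg J.toSq.hor.map (J.dom.top_vidSq _)))
        (Over.OverMorphism.ext (congrArg J.toSq.hor.map (J.dom.bot_vidSq _)))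
      sq_vcompSq := fun _ _ _ => SqHom.heq (Over.OverMorphism.ext (J.ver_vcomp _ _))
        (Over.OverMorphism.ext (J.ver_vcomp _ _)) _ _
        (Over.OverMorphism.ext (congrArg J.toSq.hor.map (J.dom.top_vcompSq _ _ _)))
        (Over.OverMorphism.ext (congrArg J.toSq.hor.map (J.dom.bot_vcompSq _ _ _))) }

end Slice

/-- The slice lifting operation: a lifting problem in `C / A` is solved by the solution of the
underlying lifting problem in `C`. -/
def LiftingOperation.slice {C : Type u} [Category.{v} C]
    {J : DoubleOver.{v, u, o₁, h₁, w₁, s₁} C} {K : DoubleOver.{v, u, o₂, h₂, w₂, s₂} C}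
    (φ : LiftingOperation J K) (A : C) : LiftingOperation (J.slice A) (K.slice A) where
  lift {a b} f {c d} g u v e := Over.homMk (U := Over.mk b.ext) (V := Over.mk c.ext)
    (φ.lift f.vert g.vert u.left v.left (congrArg Over.Hom.left e))
    (by
      have h := φ.fac_right f.vert g.vert u.left v.left (congrArg Over.Hom.left e)
      change _ ≫ c.ext = b.ext
      rw [← g.isOver, ← Category.assoc, h]
      exact Over.w v)
  fac_left {a b} f {c d} g u v e := Over.OverMorphism.ext (φ.fac_left f.vert g.vert _ _ _)
  fac_right {a b} f {c d} g u v e := Over.OverMorphism.ext (φ.fac_right f.vert g.vert _ _ _)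
  natural {x' x} α {y y'} β u v e := Over.OverMorphism.ext
    (φ.natural (SliceSq.sq α) (SliceSq.sq β) u.left v.left (congrArg Over.Hom.left e))
  lift_vcomp_left {a b c} f' f {d e} g u v i := Over.OverMorphism.ext
    (φ.lift_vcomp_left f'.vert f.vert g.vert u.left v.left (congrArg Over.Hom.left i))
  lift_vcomp_right {a b} f {c d e} g' g u v i := Over.OverMorphism.ext
    (φ.lift_vcomp_right f.vert g'.vert g.vert u.left v.left (congrArg Over.Hom.left i))

/-! ### Lifts of functors, Frobenius structures and pushforward structures -/

/-- A lift of the double functor on squares induced by `H : C ⥤ D` to a double functor from `J` to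
`K`, i.e. a filler of the strictly commuting square. -/
@[ext]
structure FunctorLift {C : Type u₁} [Category.{v₁} C] {D : Type u₂} [Category.{v₂} D] (H : C ⥤ D)
    (J : DoubleOver.{v₁, u₁, o₁, h₁, w₁, s₁} C) (K : DoubleOver.{v₂, u₂, o₂, h₂, w₂, s₂} D) where
  functor : DoubleFunctor J.dom K.dom
  comm : functor.comp K.toSq = J.toSq.comp (Sq.map H)

namespace FunctorLift

variable {C : Type u₁} [Category.{v₁} C] {D : Type u₂} [Category.{v₂} D] {H : C ⥤ D}
  {J : DoubleOver.{v₁, u₁, o₁, h₁, w₁, s₁} C} {K : DoubleOver.{v₂, u₂, o₂, h₂, w₂, s₂} D}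
  (F : FunctorLift H J K)

theorem ob_eq (a : J.dom.Obj) : K.ob (F.functor.hor.obj a) = H.obj (J.ob a) :=
  congrArg (fun G : DoubleFunctor J.dom (Sq D) => G.hor.obj a) F.comm

theorem ver_eq {a b : J.dom.Obj} (f : J.dom.Vert a b) :
    K.ver (F.functor.vert f) =
      eqToHom (F.ob_eq a) ≫ H.map (J.ver f) ≫ eqToHom (F.ob_eq b).symm := by
  have key : ∀ (G G' : DoubleFunctor J.dom (Sq D)) (e : G = G'),
      (G.vert f : G.hor.obj a ⟶ G.hor.obj b) =
        eqToHom (congrArg (fun G : DoubleFunctor J.dom (Sq D) => G.hor.obj a) e) ≫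
          (G'.vert f : G'.hor.obj a ⟶ G'.hor.obj b) ≫
          eqToHom (congrArg (fun G : DoubleFunctor J.dom (Sq D) => G.hor.obj b) e).symm := by
    intro G G' e
    subst e
    simp
  exact key _ _ F.comm

/-- The solution of a lifting problem of `H.map (J.ver f)` against a vertical morphism of `M`, given
by a lifting operation for `(K, M)` and the structure on `H.map (J.ver f)` provided by the lift. The
morphisms `eqToHom _` only rewrite along the strict commutativity. -/
def solveLeft {M : DoubleOver.{v₂, u₂, o₃, h₃, w₃, s₃} D} (ψ : LiftingOperation K M)
    {a b : J.dom.Obj} (f : J.dom.Vert a b) {c d : M.dom.Obj} (g : M.dom.Vert c d)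
    (u : H.obj (J.ob a) ⟶ M.ob c) (v : H.obj (J.ob b) ⟶ M.ob d)
    (e : u ≫ M.ver g = H.map (J.ver f) ≫ v) : H.obj (J.ob b) ⟶ M.ob c :=
  eqToHom (F.ob_eq b).symm ≫
    ψ.lift (F.functor.vert f) g (eqToHom (F.ob_eq a) ≫ u) (eqToHom (F.ob_eq b) ≫ v)
      (by rw [F.ver_eq, Category.assoc, e]; simp)

/-- The solution of a lifting problem of a vertical morphism of `M` against `H.map (J.ver g)`, given
by a lifting operation for `(M, K)` and the structure on `H.map (J.ver g)` provided by the lift. The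
morphisms `eqToHom _` only rewrite along the strict commutativity. -/
def solveRight {M : DoubleOver.{v₂, u₂, o₃, h₃, w₃, s₃} D} (ψ : LiftingOperation M K)
    {c d : M.dom.Obj} (f : M.dom.Vert c d) {a b : J.dom.Obj} (g : J.dom.Vert a b)
    (u : M.ob c ⟶ H.obj (J.ob a)) (v : M.ob d ⟶ H.obj (J.ob b))
    (e : u ≫ H.map (J.ver g) = M.ver f ≫ v) : M.ob d ⟶ H.obj (J.ob a) :=
  ψ.lift f (F.functor.vert g) (u ≫ eqToHom (F.ob_eq a).symm) (v ≫ eqToHom (F.ob_eq b).symm)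
      (by rw [F.ver_eq, Category.assoc, ← reassoc_of% e]; simp) ≫
    eqToHom (F.ob_eq a)

end FunctorLift

/-- Transposing both horizontal sides of a commutative square along an adjunction. -/
theorem transpose_comm {C : Type u₁} [Category.{v₁} C] {D : Type u₂} [Category.{v₂} D] {L : C ⥤ D}
    {R : D ⥤ C} (adj : L ⊣ R) {X Y : C} {X' Y' : D} {f : X ⟶ Y} {g : X' ⟶ Y'}
    {u : L.obj X ⟶ X'} {v : L.obj Y ⟶ Y'} (e : u ≫ g = L.map f ≫ v) :
    adj.homEquiv X X' u ≫ R.map g = f ≫ adj.homEquiv Y Y' v := by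
  rw [← adj.homEquiv_naturality_right, e, adj.homEquiv_naturality_left]

section Frobenius

variable {C : Type u} [Category.{v} C] {A B : C}

/-- A Frobenius structure on `f : A ⟶ B`: a lift of the pullback functor along `f` to a double
functor from `J / B` to `J / A`. -/
abbrev FrobeniusStructure (J : DoubleOver.{v, u, o, h, w, s} C) (f : A ⟶ B)
    [ChosenPullbacksAlong f] :=
  FunctorLift (ChosenPullbacksAlong.pullback f) (J.slice B) (J.slice A)

/-- A pushforward structure on `f : A ⟶ B`: a lift of the pushforward functor along `f` to a double
functor from `K / A` to `K / B`. -/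
abbrev PushforwardStructure (K : DoubleOver.{v, u, o, h, w, s} C) (f : A ⟶ B)
    [ChosenPullbacksAlong f] [ExponentiableMorphism f] :=
  FunctorLift (ExponentiableMorphism.pushforward f) (K.slice A) (K.slice B)

end Frobenius

end DoubleLifting

/-!
A lifting operation for `(J, K)` is the same thing as a double functor from `J` to the left dual
of `K` over the squares of `C`, and also the same thing as a double functor from `K` to the right
dual of `J` (`LiftingOperation.exists_toLeftDual_eq`, `LiftingOperation.exists_toRightDual_eq`).
Hence, if `J / A` is the left dual of `K / A`, then a Frobenius structure on `f : A ⟶ B` amounts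
to a lifting operation of the morphisms `f^* j`, for `j` in `J / B`, against the morphisms of
`K / A`; and if `K / B` is the right dual of `J / B`, then a pushforward structure on `f` amounts to a
lifting operation of the morphisms of `J / B` against the morphisms `f_* k`, for `k` in `K / A`
(`FunctorLift.exists_equiv_of_toLeftDual`, `FunctorLift.exists_equiv_of_toRightDual`). These two
kinds of lifting operations correspond to each other by transposing fillers along `f^* ⊣ f_*`
(`LiftingOperation.transpose`).

It remains to see that closedness passes to slices. For the right dual this is immediate: a
lifting problem in `C` of `j` against a morphism over `A` makes the target of `j`, and so `j`
itself, an object over `A` (`LiftingOperation.isBijective_toRightDual_slice`). For the left dual,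
a lifting problem `(u, v)` in `C` of a morphism over `A` with target `Y` against `k` in `K` is
first moved over `A` by replacing `k` by its pullback along `v`, whose target `Y` lies over `A`.
The pullback belongs to `K` because right lifting operations are stable under pullback and `K` is
a right dual (`LiftingOperation.hasPullbackSquares`). That the resulting fillers do not depend on
the way in which the problem is moved over `A` (`LeftLift.existsUnique_isFillerVia`) gives their
naturality and their compatibility with vertical composition
(`LiftingOperation.isBijective_toLeftDual_slice`).

Equalities of double functors involve equalities of objects. To keep casts out of the arguments,
invertibility of a double functor is replaced throughout by bijectivity on objects and on
morphisms and squares with a given boundary (`DoubleFunctor.IsInvertible.isBijective`,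
`DoubleFunctor.IsBijective.isInvertible`).
-/

namespace DoubleLifting

/-! ### Bijective double functors -/

namespace DoubleFunctor

variable {D : DoubleCategory.{o₁, h₁, w₁, s₁}} {E : DoubleCategory.{o₂, h₂, w₂, s₂}}

/-- A double functor that is bijective on objects, and on horizontal morphisms, vertical morphisms
and squares with a given boundary. -/
structure IsBijective (F : DoubleFunctor D E) : Prop where
  obj : Function.Bijective F.hor.obj
  map : ∀ a b : D.Obj, Function.Bijective (F.hor.map : (a ⟶ b) → _)
  vert : ∀ a b : D.Obj, Function.Bijective (F.vert : D.Vert a b → _)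
  sq : ∀ x y : VertArrow D.Vert, Function.Bijective (F.sq : (x ⟶ y) → _)

theorem isBijective_id (D : DoubleCategory.{o₁, h₁, w₁, s₁}) : (DoubleFunctor.id D).IsBijective :=
  ⟨Function.bijective_id, fun _ _ => Function.bijective_id, fun _ _ => Function.bijective_id,
    fun _ _ => Function.bijective_id⟩

/-- If `F ∘ G` and `F` are bijective, then so is `G`. -/
theorem IsBijective.of_comp_right {E' : DoubleCategory.{o₃, h₃, w₃, s₃}} {G : DoubleFunctor D E}
    {F : DoubleFunctor E E'} (hGF : (G.comp F).IsBijective) (hF : F.IsBijective) :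
    G.IsBijective where
  obj := (Function.Bijective.of_comp_iff' hF.obj _).1 hGF.obj
  map a b := (Function.Bijective.of_comp_iff' (hF.map _ _) _).1 (hGF.map a b)
  vert a b := (Function.Bijective.of_comp_iff' (hF.vert _ _) _).1 (hGF.vert a b)
  sq x y := (Function.Bijective.of_comp_iff' (hF.sq _ _) _).1 (hGF.sq x y)

/-- A map `p` is bijective if `q ∘ p` and `r ∘ q` are: then `q` is surjective and injective. -/
theorem bijective_of_comp_of_comp {α : Sort*} {β : Sort*} {γ : Sort*} {δ : Sort*} {p : α → β}
    {q : β → γ} {r : γ → δ} (hqp : Function.Bijective (q ∘ p)) (hrq : Function.Bijective (r ∘ q)) :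
    Function.Bijective p :=
  (Function.Bijective.of_comp_iff' ⟨hrq.injective.of_comp, hqp.surjective.of_comp⟩ _).1 hqp

theorem IsInvertible.isBijective {F : DoubleFunctor D E} (hF : F.IsInvertible) :
    F.IsBijective := by
  obtain ⟨G, hFG, hGF⟩ := hF
  have h₁ : (F.comp G).IsBijective := hFG ▸ isBijective_id D
  have h₂ : (G.comp F).IsBijective := hGF ▸ isBijective_id E
  exact ⟨bijective_of_comp_of_comp h₁.obj h₂.obj,
    fun a b => bijective_of_comp_of_comp (h₁.map a b) (h₂.map _ _),
    fun a b => bijective_of_comp_of_comp (h₁.vert a b) (h₂.vert _ _),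
    fun x y => bijective_of_comp_of_comp (h₁.sq x y) (h₂.sq _ _)⟩

/-- A bijective double functor reflects the heterogeneous equality of squares. -/
theorem IsBijective.heq_of_sq_heq {F : DoubleFunctor D E} (hF : F.IsBijective) {a b a' b' : D.Obj}
    {f₁ f₂ : D.Vert a b} {g₁ g₂ : D.Vert a' b'} (hf : f₁ = f₂) (hg : g₁ = g₂)
    {α₁ : (⟨a, b, f₁⟩ : VertArrow D.Vert) ⟶ ⟨a', b', g₁⟩}
    {α₂ : (⟨a, b, f₂⟩ : VertArrow D.Vert) ⟶ ⟨a', b', g₂⟩} (hα : HEq (F.sq α₁) (F.sq α₂)) :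
    HEq α₁ α₂ := by
  subst hf hg
  exact heq_of_eq ((hF.sq _ _).injective (eq_of_heq hα))

/-- Every double functor factors through a bijective one. -/
theorem IsBijective.exists_comp_eq {X : DoubleCategory.{o₃, h₃, w₃, s₃}} {F : DoubleFunctor D E}
    (hF : F.IsBijective) (H : DoubleFunctor X E) : ∃ L : DoubleFunctor X D, L.comp F = H := by
  obtain ⟨⟨obj₀, map₀, map_id, map_comp⟩, vert, sq, sq_id, sq_comp, top_sq, bot_sq, vert_vid,
    vert_vcomp, sq_vidSq, sq_vcompSq⟩ := H
  -- The preimages are chosen one level at a time; after substituting the given data by the images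
  -- of the chosen preimages, the next level has the right type without any casts.
  obtain ⟨obj, rfl⟩ : ∃ g : X.Obj → D.Obj, (fun x => F.hor.obj (g x)) = obj₀ :=
    ⟨fun x => (hF.obj.surjective (obj₀ x)).choose,
      funext fun x => (hF.obj.surjective (obj₀ x)).choose_spec⟩
  obtain ⟨map, rfl⟩ : ∃ m : ∀ {x y : X.Obj}, (x ⟶ y) → (obj x ⟶ obj y),
      (fun {x y} k => F.hor.map (m (x := x) (y := y) k)) = @map₀ :=
    ⟨fun k => ((hF.map _ _).surjective (map₀ k)).choose, by
      funext x y k; exact ((hF.map _ _).surjective (map₀ k)).choose_spec⟩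
  obtain ⟨vert, rfl⟩ : ∃ m : ∀ {x y : X.Obj}, X.Vert x y → D.Vert (obj x) (obj y),
      (fun {x y} k => F.vert (m (x := x) (y := y) k)) = @vert :=
    ⟨fun k => ((hF.vert _ _).surjective (vert k)).choose, by
      funext x y k; exact ((hF.vert _ _).surjective (vert k)).choose_spec⟩
  obtain ⟨sq, rfl⟩ : ∃ m : ∀ {x y : VertArrow X.Vert}, (x ⟶ y) →
        ((⟨obj x.src, obj x.tgt, vert x.arr⟩ : VertArrow D.Vert) ⟶
          ⟨obj y.src, obj y.tgt, vert y.arr⟩),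
      (fun {x y} k => F.sq (m (x := x) (y := y) k)) = @sq :=
    ⟨fun {x y} k => ((hF.sq ⟨obj x.src, obj x.tgt, vert x.arr⟩
        ⟨obj y.src, obj y.tgt, vert y.arr⟩).surjective (sq k)).choose, by
      funext x y k
      exact ((hF.sq ⟨obj x.src, obj x.tgt, vert x.arr⟩
        ⟨obj y.src, obj y.tgt, vert y.arr⟩).surjective (sq k)).choose_spec⟩
  have hvid : ∀ a : X.Obj, vert (X.vid a) = D.vid (obj a) := fun a =>
    (hF.vert _ _).injective ((vert_vid a).trans (F.vert_vid _).symm)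
  have hvcomp : ∀ {a b c : X.Obj} (f : X.Vert a b) (g : X.Vert b c),
      vert (X.vcomp f g) = D.vcomp (vert f) (vert g) := fun f g =>
    (hF.vert _ _).injective ((vert_vcomp f g).trans (F.vert_vcomp _ _).symm)
  have htop : ∀ {x y : VertArrow X.Vert} (α : x ⟶ y), D.top (sq α) = map (X.top α) := fun α =>
    (hF.map _ _).injective ((F.top_sq _).symm.trans (top_sq α))
  have hbot : ∀ {x y : VertArrow X.Vert} (α : x ⟶ y), D.bot (sq α) = map (X.bot α) := fun α =>
    (hF.map _ _).injective ((F.bot_sq _).symm.trans (bot_sq α))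
  exact ⟨
    { hor :=
        { obj := obj
          map := map
          map_id := fun a => (hF.map _ _).injective ((map_id a).trans (F.hor.map_id _).symm)
          map_comp := fun k l =>
            (hF.map _ _).injective ((map_comp k l).trans (F.hor.map_comp _ _).symm) }
      vert := vert
      sq := sq
      sq_id := fun x => (hF.sq _ _).injective ((sq_id x).trans
        (F.sq_id ⟨obj x.src, obj x.tgt, vert x.arr⟩).symm)
      sq_comp := fun α β => (hF.sq _ _).injective ((sq_comp α β).trans (F.sq_comp _ _).symm)
      top_sq := htop
      bot_sq := hbot
      vert_vid := hvid
      vert_vcomp := hvcomp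
      sq_vidSq := fun k => hF.heq_of_sq_heq (hvid _) (hvid _)
        ((sq_vidSq k).trans (F.sq_vidSq _).symm)
      sq_vcompSq := fun α β e => hF.heq_of_sq_heq (hvcomp _ _) (hvcomp _ _)
        ((sq_vcompSq α β e).trans (F.sq_vcompSq _ _ _).symm) }, rfl⟩

theorem IsBijective.isInvertible {F : DoubleFunctor D E} (hF : F.IsBijective) :
    F.IsInvertible := by
  obtain ⟨G, hG⟩ := hF.exists_comp_eq (DoubleFunctor.id E)
  have hG' : G.IsBijective := .of_comp_right (hG ▸ isBijective_id E) hF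
  obtain ⟨G', h⟩ := hG'.exists_comp_eq (DoubleFunctor.id D)
  -- The left inverse `G'` and the right inverse `F` of `G` agree.
  have : G' = F :=
    calc G' = G'.comp (G.comp F) := by rw [hG]; rfl
      _ = (G'.comp G).comp F := rfl
      _ = F := by rw [h]; rfl
  exact ⟨G, this ▸ h, hG⟩

end DoubleFunctor

/-! ### Slices and right duals -/

theorem DoubleOver.bijective_slice_ob {C : Type u} [Category.{v} C]
    {K : DoubleOver.{v, u, o, h, w, s} C} (hK : Function.Bijective K.ob) (A : C) :
    Function.Bijective (K.slice A).ob := by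
  refine ⟨fun x y e => ?_, fun Y => ?_⟩
  · obtain ⟨p, k⟩ := x
    obtain ⟨q, l⟩ := y
    obtain rfl : p = q := hK.injective (congrArg Comma.left e)
    have hom_heq : ∀ {Y Z : Over A}, Y = Z → HEq Y.hom Z.hom := by rintro Y _ rfl; rfl
    obtain rfl : k = l := eq_of_heq (hom_heq e)
    rfl
  · have : ∀ (Z : C) (l : Z ⟶ A), ∃ x : SliceObj K A, (K.slice A).ob x = Over.mk l := by
      intro Z l
      obtain ⟨p, rfl⟩ := hK.surjective Z
      exact ⟨⟨p, l⟩, rfl⟩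
    exact this Y.left Y.hom

theorem DoubleOver.bijective_slice_hor {C : Type u} [Category.{v} C]
    {K : DoubleOver.{v, u, o, h, w, s} C}
    (hK : ∀ a b : K.dom.Obj, Function.Bijective (K.hor : (a ⟶ b) → _)) {A : C}
    (x y : (K.slice A).dom.Obj) : Function.Bijective ((K.slice A).hor : (x ⟶ y) → _) := by
  refine ⟨fun k l e => SliceHor.ext ((hK _ _).injective (congrArg Over.Hom.left e)), fun m => ?_⟩
  obtain ⟨k, hk⟩ := (hK x.pt y.pt).surjective m.left
  exact ⟨⟨k, by rw [hk]; exact Over.w m⟩, Over.OverMorphism.ext hk⟩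

section Right

variable {C : Type u} [Category.{v} C] {J : DoubleOver.{v, u, o₁, h₁, w₁, s₁} C}
  {K : DoubleOver.{v, u, o₂, h₂, w₂, s₂} C} {A : C}

/-- A lifting operation of `J` against a morphism over `A` restricts to one of `J / A`. -/
@[reducible]
def RightLift.slice {X Y : Over A} (r : RightLift J X.left Y.left) (hr : r.arr ≫ Y.hom = X.hom) :
    RightLift (J.slice A) X Y where
  arr := Over.homMk r.arr hr
  lift {a b} f u v e := Over.homMk (U := Over.mk b.ext)
    (r.lift f.vert u.left v.left (congrArg Over.Hom.left e)) (by
      have h := r.fac_right f.vert u.left v.left (congrArg Over.Hom.left e)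
      change _ ≫ X.hom = b.ext
      rw [← hr, ← Category.assoc, h]
      exact Over.w v)
  fac_left f u v e := Over.OverMorphism.ext (r.fac_left f.vert _ _ _)
  fac_right f u v e := Over.OverMorphism.ext (r.fac_right f.vert _ _ _)
  natural α u v e := Over.OverMorphism.ext (r.natural (SliceSq.sq α) u.left v.left
    (congrArg Over.Hom.left e))
  lift_vcomp f' f u v i := Over.OverMorphism.ext (r.lift_vcomp f'.vert f.vert u.left v.left
    (congrArg Over.Hom.left i))

/-- A vertical morphism of `J`, regarded as one of `J / A` by means of a map from its target to
`A`. -/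
abbrev SliceVert.ofTarget {a b : J.dom.Obj} (f : J.dom.Vert a b) (p : J.ob b ⟶ A) :
    SliceVert (J := J) (A := A) ⟨a, J.ver f ≫ p⟩ ⟨b, p⟩ :=
  ⟨f, rfl⟩

theorem RightLift.slice_injective {X Y : Over A} {r r' : RightLift J X.left Y.left}
    {hr : r.arr ≫ Y.hom = X.hom} {hr' : r'.arr ≫ Y.hom = X.hom}
    (h : r.slice hr = r'.slice hr') : r = r' := by
  have ha : r.arr = r'.arr := congrArg (fun t => t.arr.left) h
  refine RightLift.ext_lift ha fun {a b} f u v e e' => ?_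
  have hu : u ≫ X.hom = J.ver f ≫ v ≫ Y.hom := by rw [← hr, reassoc_of% e]
  have key : ∀ (ℓ ℓ' : RightLift (J.slice A) X Y), ℓ = ℓ' → ∀ e e',
      ℓ.lift (SliceVert.ofTarget f (v ≫ Y.hom)) (Over.homMk u hu) (Over.homMk v rfl) e =
      ℓ'.lift (SliceVert.ofTarget f (v ≫ Y.hom)) (Over.homMk u hu) (Over.homMk v rfl) e' := by
    rintro ℓ _ rfl e e'; rfl
  exact congrArg Over.Hom.left
    (key _ _ h (Over.OverMorphism.ext e) (Over.OverMorphism.ext e'))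

/-- The solution of a lifting problem over `A` depends only on the underlying lifting problem in
`C`: the structure maps to `A` are determined by the map to `Y`. -/
theorem RightLift.lift_left_eq_ofTarget {X Y : Over A} (ℓ : RightLift (J.slice A) X Y)
    {x y : SliceObj J A} (F : SliceVert x y) (U : (J.slice A).ob x ⟶ X)
    (V : (J.slice A).ob y ⟶ Y) (e : U ≫ ℓ.arr = (J.slice A).ver F ≫ V)
    (hu : U.left ≫ X.hom = J.ver F.vert ≫ V.left ≫ Y.hom) (e') :
    (ℓ.lift F U V e).left = (ℓ.lift (SliceVert.ofTarget F.vert (V.left ≫ Y.hom))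
      (Over.homMk U.left hu) (Over.homMk V.left rfl) e').left := by
  obtain ⟨a, p⟩ := x
  obtain ⟨b, q⟩ := y
  obtain ⟨f, hf⟩ := F
  change J.dom.Vert a b at f
  obtain rfl : J.ver f ≫ q = p := hf
  obtain ⟨v, rfl, rfl⟩ : ∃ (v : J.ob b ⟶ Y.left) (hv : v ≫ Y.hom = q),
      V = Over.homMk (U := Over.mk q) v hv := ⟨V.left, Over.w V, rfl⟩
  rfl

/-- Lifting operations of `J / A` come from lifting operations of `J`: every lifting problem in `C`
against a morphism over `A` is a lifting problem over `A`. -/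
theorem RightLift.exists_slice_eq {X Y : Over A} (ℓ : RightLift (J.slice A) X Y) :
    ∃ (r : RightLift J X.left Y.left) (hr : r.arr ≫ Y.hom = X.hom), r.slice hr = ℓ := by
  have hu : ∀ {a b : J.dom.Obj} {f : J.dom.Vert a b} {u : J.ob a ⟶ X.left} {v : J.ob b ⟶ Y.left},
      u ≫ ℓ.arr.left = J.ver f ≫ v → u ≫ X.hom = J.ver f ≫ v ≫ Y.hom := fun e => by
    rw [← Over.w ℓ.arr, reassoc_of% e]
  refine ⟨{
    arr := ℓ.arr.left
    lift := fun f u v e => (ℓ.lift (SliceVert.ofTarget f (v ≫ Y.hom)) (Over.homMk u (hu e))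
      (Over.homMk v rfl) (Over.OverMorphism.ext e)).left
    fac_left := fun f u v e => congrArg Over.Hom.left
      (ℓ.fac_left (SliceVert.ofTarget f (v ≫ Y.hom)) (Over.homMk u (hu e)) (Over.homMk v rfl) _)
    fac_right := fun f u v e => congrArg Over.Hom.left
      (ℓ.fac_right (SliceVert.ofTarget f (v ≫ Y.hom)) (Over.homMk u (hu e)) (Over.homMk v rfl) _)
    natural := ?_
    lift_vcomp := ?_ }, Over.w ℓ.arr, ?_⟩
  · intro x' x α u v e
    have h := congrArg Over.Hom.left (ℓ.natural
      (x' := ⟨_, _, SliceVert.ofTarget x'.arr ((J.hor (J.dom.bot α) ≫ v) ≫ Y.hom)⟩)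
      (x := ⟨_, _, SliceVert.ofTarget x.arr (v ≫ Y.hom)⟩)
      (SliceSq.mk α (by
          change J.hor _ ≫ J.ver x.arr ≫ v ≫ Y.hom = J.ver x'.arr ≫ (_ ≫ v) ≫ Y.hom
          rw [← Category.assoc, J.sq_comm α]; simp only [Category.assoc])
        (Category.assoc _ _ _).symm)
      (Over.homMk u (hu e)) (Over.homMk v rfl) (Over.OverMorphism.ext e))
    exact h
  · intro a b c f' f u v i
    have h := congrArg Over.Hom.left (ℓ.lift_vcomp
      (a := ⟨a, J.ver (J.dom.vcomp f' f) ≫ v ≫ Y.hom⟩) (b := ⟨b, J.ver f ≫ v ≫ Y.hom⟩)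
      (c := ⟨c, v ≫ Y.hom⟩)
      ⟨f', by rw [J.ver_vcomp, Category.assoc]⟩ (SliceVert.ofTarget f (v ≫ Y.hom))
      (Over.homMk u (hu i)) (Over.homMk v rfl) (Over.OverMorphism.ext i))
    refine h.trans ?_
    congr 2
    exact Over.OverMorphism.ext (ℓ.lift_left_eq_ofTarget _ _ _ _ _ _)
  · exact RightLift.ext_lift rfl fun F U V e e' => Over.OverMorphism.ext
      (ℓ.lift_left_eq_ofTarget F U V e' _ _).symm

/-- If `K` is the right dual of `J`, then `K / A` is the right dual of `J / A`. -/
theorem LiftingOperation.isBijective_toRightDual_slice {φ : LiftingOperation J K}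
    (h : φ.toRightDual.IsBijective) (A : C) : (φ.slice A).toRightDual.IsBijective where
  obj := DoubleOver.bijective_slice_ob h.obj A
  map := DoubleOver.bijective_slice_hor h.map
  vert x y := by
    refine ⟨fun g g' e => SliceVert.ext ((h.vert _ _).injective ?_), fun ℓ => ?_⟩
    · exact RightLift.slice_injective (X := (K.slice A).ob x) (Y := (K.slice A).ob y)
        (r := φ.rightLift g.vert) (r' := φ.rightLift g'.vert) (hr := g.isOver)
        (hr' := g'.isOver) e
    · obtain ⟨r, hr, rfl⟩ := RightLift.exists_slice_eq (X := (K.slice A).ob x)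
        (Y := (K.slice A).ob y) ℓ
      obtain ⟨g, rfl⟩ := (h.vert x.pt y.pt).surjective r
      exact ⟨⟨g, hr⟩, rfl⟩
  sq x y := by
    refine ⟨fun α β e => SliceSq.ext ((h.sq _ _).injective ?_), fun α => ?_⟩
    · exact RightLiftHom.ext (congrArg (fun t => t.top.left) e) (congrArg (fun t => t.bot.left) e)
    · obtain ⟨β, hβ⟩ := (h.sq ⟨_, _, x.arr.vert⟩ ⟨_, _, y.arr.vert⟩).surjective
        (RightLiftHom.mk α.top.left α.bot.left (congrArg Over.Hom.left α.comm)
          fun f (u : J.ob _ ⟶ K.ob x.src.pt) (v : J.ob _ ⟶ K.ob x.tgt.pt)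
              (e : u ≫ K.ver x.arr.vert = J.ver f ≫ v) => congrArg Over.Hom.left
            (α.lift_comm (SliceVert.ofTarget f (v ≫ x.tgt.ext))
              (Over.homMk u (by
                change u ≫ x.src.ext = J.ver f ≫ v ≫ x.tgt.ext
                rw [← x.arr.isOver, reassoc_of% e]))
              (Over.homMk v rfl) (Over.OverMorphism.ext e)))
      have ht : K.hor (K.dom.top β) = α.top.left := congrArg RightLiftHom.top hβ
      have hb : K.hor (K.dom.bot β) = α.bot.left := congrArg RightLiftHom.bot hβ
      exact ⟨⟨β, by rw [ht]; exact Over.w α.top, by rw [hb]; exact Over.w α.bot⟩,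
        RightLiftHom.ext (Over.OverMorphism.ext ht) (Over.OverMorphism.ext hb)⟩

end Right

/-! ### Pullbacks of vertical morphisms -/

section PullbackSquares

variable {C : Type u} [Category.{v} C] {J : DoubleOver.{v, u, o₁, h₁, w₁, s₁} C}
  {K : DoubleOver.{v, u, o₂, h₂, w₂, s₂} C}

/-- A choice-free form of the statement that the vertical morphisms of `K` can be pulled back along
maps into their targets: there is a square from the pullback that is a pullback square in `C` and
cartesian for the squares of `K`. The target of the pulled back morphism is prescribed strictly. -/
def DoubleOver.HasPullbackSquares (K : DoubleOver.{v, u, o, h, w, s} C) : Prop :=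
  ∀ {c d d' : K.dom.Obj} (g : K.dom.Vert c d) (p : K.ob d' ⟶ K.ob d),
    ∃ (c' : K.dom.Obj) (g' : K.dom.Vert c' d')
      (β : (⟨c', d', g'⟩ : VertArrow K.dom.Vert) ⟶ ⟨c, d, g⟩),
      K.hor (K.dom.bot β) = p ∧ IsPullback (K.hor (K.dom.top β)) (K.ver g') (K.ver g) p ∧
      ∀ (x : VertArrow K.dom.Vert) (γ : x ⟶ ⟨c, d, g⟩) (t : K.ob x.src ⟶ K.ob c')
        (b : K.ob x.tgt ⟶ K.ob d'), t ≫ K.hor (K.dom.top β) = K.hor (K.dom.top γ) →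
        b ≫ p = K.hor (K.dom.bot γ) → t ≫ K.ver g' = K.ver x.arr ≫ b →
        ∃ δ : x ⟶ ⟨c', d', g'⟩, K.hor (K.dom.top δ) = t ∧ K.hor (K.dom.bot δ) = b

/-- Lifting operations of `J` against a morphism can be transferred to its pullbacks. -/
@[reducible]
noncomputable def RightLift.ofIsPullback {X Y Z W : C} (r : RightLift J X Y) {t : Z ⟶ X}
    {m : Z ⟶ W} {p : W ⟶ Y} (hp : IsPullback t m r.arr p) : RightLift J Z W where
  arr := m
  lift f u v e := hp.lift
    (r.lift f (u ≫ t) (v ≫ p) (by rw [Category.assoc, hp.w, reassoc_of% e])) v (r.fac_right _ _ _ _)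
  fac_left f u v e := hp.hom_ext
    (by rw [Category.assoc, hp.lift_fst, r.fac_left]) (by rw [Category.assoc, hp.lift_snd, e])
  fac_right f u v e := hp.lift_snd _ _ _
  natural α u v e := hp.hom_ext
    (by
      rw [hp.lift_fst, Category.assoc _ (hp.lift _ _ _) t, hp.lift_fst, ← r.natural α]
      congr 1 <;> simp only [Category.assoc])
    (by rw [hp.lift_snd, Category.assoc _ (hp.lift _ _ _) m, hp.lift_snd])
  lift_vcomp f' f u v i := hp.hom_ext
    (by
      rw [hp.lift_fst, hp.lift_fst, r.lift_vcomp]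
      congr 1
      rw [hp.lift_fst]
      congr 1
      simp only [Category.assoc])
    (by rw [hp.lift_snd, hp.lift_snd])

/-- If `K` is a right dual, its vertical morphisms can be pulled back: the pullback carries the
transferred lifting operation, and the pullback square is cartesian because fillers with values in a
pullback are determined by their two components. -/
theorem LiftingOperation.hasPullbackSquares [HasPullbacks C] {φ : LiftingOperation J K}
    (h : φ.toRightDual.IsBijective) : K.HasPullbackSquares := by
  intro c d d' g p
  obtain ⟨Z, t, m, hp⟩ : ∃ (Z : C) (t : Z ⟶ K.ob c) (m : Z ⟶ K.ob d'),
      IsPullback t m (K.ver g) p := ⟨_, _, _, IsPullback.of_hasPullback (K.ver g) p⟩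
  obtain ⟨c', rfl⟩ : ∃ c', K.ob c' = Z := h.obj.surjective Z
  obtain ⟨g', hg'⟩ := (h.vert c' d').surjective ((φ.rightLift g).ofIsPullback hp)
  obtain rfl : K.ver g' = m := congrArg RightLift.arr hg'
  have hl : ∀ {a b : J.dom.Obj} (f : J.dom.Vert a b) (u : J.ob a ⟶ K.ob c') (v : J.ob b ⟶ K.ob d')
      (e : u ≫ K.ver g' = J.ver f ≫ v), φ.lift f g' u v e =
        ((φ.rightLift g).ofIsPullback hp).lift f u v e := by
    intro a b f u v e
    have key : ∀ r r' : RightLift J (K.ob c') (K.ob d'), r = r' → ∀ e e',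
        r.lift f u v e = r'.lift f u v e' := by
      rintro r _ rfl _ _; rfl
    exact key (φ.rightLift g') _ hg' e e
  obtain ⟨β, hβ⟩ := (h.sq ⟨c', d', g'⟩ ⟨c, d, g⟩).surjective
    (RightLiftHom.mk t p hp.w fun f u v e =>
      ((congrArg (· ≫ t) (hl f u v e)).trans (hp.lift_fst _ _ _)).symm)
  obtain rfl : K.hor (K.dom.top β) = t := congrArg RightLiftHom.top hβ
  obtain rfl : K.hor (K.dom.bot β) = p := congrArg RightLiftHom.bot hβ
  refine ⟨c', g', β, rfl, hp, fun x γ t b ht hb e => ?_⟩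
  have hδ : ∀ {a b' : J.dom.Obj} (f : J.dom.Vert a b') (u : J.ob a ⟶ K.ob x.src)
      (v : J.ob b' ⟶ K.ob x.tgt) (e' : u ≫ K.ver x.arr = J.ver f ≫ v),
      φ.lift f g' (u ≫ t) (v ≫ b) (by rw [Category.assoc, e, reassoc_of% e']) =
        φ.lift f x.arr u v e' ≫ t := by
    intro a b' f u v e'
    refine hp.hom_ext ?_ ?_
    · have hγ : φ.lift f g (u ≫ K.hor (K.dom.top γ)) (v ≫ K.hor (K.dom.bot γ)) _ =
          φ.lift f x.arr u v e' ≫ K.hor (K.dom.top γ) := (φ.toRightDual.sq γ).lift_comm f u v e'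
      rw [hl, hp.lift_fst, Category.assoc (φ.lift _ _ _ _ _), ht, ← hγ]
      dsimp only
      congr 1 <;> simp only [Category.assoc, ht, hb]
    · rw [φ.fac_right, Category.assoc (φ.lift _ _ _ _ _), e, ← Category.assoc, φ.fac_right]
  obtain ⟨δ, hδ'⟩ := (h.sq x ⟨c', d', g'⟩).surjective (RightLiftHom.mk t b e hδ)
  exact ⟨δ, congrArg RightLiftHom.top hδ', congrArg RightLiftHom.bot hδ'⟩

end PullbackSquares

/-! ### Slices and left duals -/

section Left

variable {C : Type u} [Category.{v} C] {J : DoubleOver.{v, u, o₁, h₁, w₁, s₁} C}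
  {K : DoubleOver.{v, u, o₂, h₂, w₂, s₂} C} {A : C}

/-- A lifting operation of a morphism over `A` against `K` restricts to one against `K / A`. -/
@[reducible]
def LeftLift.slice {X Y : Over A} (r : LeftLift K X.left Y.left) (hr : r.arr ≫ Y.hom = X.hom) :
    LeftLift (K.slice A) X Y where
  arr := Over.homMk r.arr hr
  lift {c d} g u v e := Over.homMk (V := Over.mk c.ext)
    (r.lift g.vert u.left v.left (congrArg Over.Hom.left e)) (by
      have h := r.fac_right g.vert u.left v.left (congrArg Over.Hom.left e)
      change _ ≫ c.ext = Y.hom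
      rw [← g.isOver, ← Category.assoc, h]
      exact Over.w v)
  fac_left g u v e := Over.OverMorphism.ext (r.fac_left g.vert _ _ _)
  fac_right g u v e := Over.OverMorphism.ext (r.fac_right g.vert _ _ _)
  natural β u v e := Over.OverMorphism.ext (r.natural (SliceSq.sq β) u.left v.left
    (congrArg Over.Hom.left e))
  lift_vcomp g' g u v i := Over.OverMorphism.ext (r.lift_vcomp g'.vert g.vert u.left v.left
    (congrArg Over.Hom.left i))

/-- The morphism `w` is a filler of the lifting problem `(u, v)` in `C` against `g` that is
obtained by solving, with `ℓ`, a lifting problem over `A` against a vertical morphism `y` of `K / A`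
and composing the solution with a square of `K` from `y` to `g`. -/
def LeftLift.IsFillerVia {X Y : Over A} (ℓ : LeftLift (K.slice A) X Y) {c d : K.dom.Obj}
    (g : K.dom.Vert c d) (u : X.left ⟶ K.ob c) (v : Y.left ⟶ K.ob d) (w : Y.left ⟶ K.ob c) : Prop :=
  ∃ (y : VertArrow (K.slice A).dom.Vert)
    (β : (⟨y.src.pt, y.tgt.pt, y.arr.vert⟩ : VertArrow K.dom.Vert) ⟶ ⟨c, d, g⟩)
    (u' : X ⟶ (K.slice A).ob y.src) (v' : Y ⟶ (K.slice A).ob y.tgt)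
    (e : u' ≫ (K.slice A).ver y.arr = ℓ.arr ≫ v'),
    u'.left ≫ K.hor (K.dom.top β) = u ∧ v'.left ≫ K.hor (K.dom.bot β) = v ∧
      (ℓ.lift y.arr u' v' e).left ≫ K.hor (K.dom.top β) = w

theorem LeftLift.isFillerVia_of_slice {X Y : Over A} (ℓ : LeftLift (K.slice A) X Y)
    {c d : (K.slice A).dom.Obj} (g : (K.slice A).dom.Vert c d) (u : X ⟶ (K.slice A).ob c)
    (v : Y ⟶ (K.slice A).ob d) (e : u ≫ (K.slice A).ver g = ℓ.arr ≫ v) :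
    ℓ.IsFillerVia g.vert u.left v.left (ℓ.lift g u v e).left :=
  ⟨⟨c, d, g⟩, 𝟙 _, u, v, e, by rw [K.dom.top_id, K.hor_id]; exact Category.comp_id _,
    by rw [K.dom.bot_id, K.hor_id]; exact Category.comp_id _,
    by rw [K.dom.top_id, K.hor_id]; exact Category.comp_id _⟩

theorem LeftLift.IsFillerVia.comp {X Y : Over A} {ℓ : LeftLift (K.slice A) X Y}
    {y y' : VertArrow K.dom.Vert} (β : y ⟶ y') {u : X.left ⟶ K.ob y.src}
    {v : Y.left ⟶ K.ob y.tgt} {w : Y.left ⟶ K.ob y.src} (h : ℓ.IsFillerVia y.arr u v w) :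
    ℓ.IsFillerVia y'.arr (u ≫ K.hor (K.dom.top β)) (v ≫ K.hor (K.dom.bot β))
      (w ≫ K.hor (K.dom.top β)) := by
  obtain ⟨z, γ, u', v', e, rfl, rfl, rfl⟩ := h
  refine ⟨z, γ ≫ β, u', v', e, ?_, ?_, ?_⟩
  · rw [K.dom.top_comp, K.hor_comp, Category.assoc]
  · rw [K.dom.bot_comp, K.hor_comp, Category.assoc]
  · rw [K.dom.top_comp, K.hor_comp, Category.assoc]

theorem LeftLift.IsFillerVia.fac_left {X Y : Over A} {ℓ : LeftLift (K.slice A) X Y}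
    {c d : K.dom.Obj} {g : K.dom.Vert c d} {u : X.left ⟶ K.ob c} {v : Y.left ⟶ K.ob d}
    {w : Y.left ⟶ K.ob c} (h : ℓ.IsFillerVia g u v w) : ℓ.arr.left ≫ w = u := by
  obtain ⟨z, γ, u', v', e, rfl, rfl, rfl⟩ := h
  have := congrArg Over.Hom.left (ℓ.fac_left z.arr u' v' e)
  rw [Over.comp_left] at this
  rw [← this, Category.assoc]

theorem LeftLift.IsFillerVia.fac_right {X Y : Over A} {ℓ : LeftLift (K.slice A) X Y}
    {c d : K.dom.Obj} {g : K.dom.Vert c d} {u : X.left ⟶ K.ob c} {v : Y.left ⟶ K.ob d}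
    {w : Y.left ⟶ K.ob c} (h : ℓ.IsFillerVia g u v w) : w ≫ K.ver g = v := by
  obtain ⟨z, γ, u', v', e, rfl, rfl, rfl⟩ := h
  have := congrArg Over.Hom.left (ℓ.fac_right z.arr u' v' e)
  rw [Over.comp_left] at this
  rw [← this, Category.assoc, K.sq_comm γ, Category.assoc]
  rfl

/-- Naturality with respect to the squares of `K / A`, with the composite lifting problem given up
to propositional equality. -/
theorem LeftLift.lift_left_natural {X Y : Over A} (ℓ : LeftLift (K.slice A) X Y)
    {y y' : VertArrow (K.slice A).dom.Vert} (σ : y ⟶ y') {u : X ⟶ (K.slice A).ob y.src}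
    {v : Y ⟶ (K.slice A).ob y.tgt} (e : u ≫ (K.slice A).ver y.arr = ℓ.arr ≫ v)
    {u' : X ⟶ (K.slice A).ob y'.src} {v' : Y ⟶ (K.slice A).ob y'.tgt}
    (e' : u' ≫ (K.slice A).ver y'.arr = ℓ.arr ≫ v')
    (hu : u.left ≫ K.hor (K.dom.top (SliceSq.sq σ)) = u'.left)
    (hv : v.left ≫ K.hor (K.dom.bot (SliceSq.sq σ)) = v'.left) :
    (ℓ.lift y'.arr u' v' e').left =
      (ℓ.lift y.arr u v e).left ≫ K.hor (K.dom.top (SliceSq.sq σ)) := by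
  obtain rfl : u ≫ (K.slice A).hor ((K.slice A).dom.top σ) = u' := Over.OverMorphism.ext hu
  obtain rfl : v ≫ (K.slice A).hor ((K.slice A).dom.bot σ) = v' := Over.OverMorphism.ext hv
  exact congrArg Over.Hom.left (ℓ.natural σ u v e)

/-- Every lifting problem has exactly one filler in the sense of `IsFillerVia`: the one that is
found by pulling `g` back along `v`, to a morphism over `A` with target `Y`. -/
theorem LeftLift.existsUnique_isFillerVia (hK : K.HasPullbackSquares)
    (hob : Function.Bijective K.ob) {X Y : Over A} (ℓ : LeftLift (K.slice A) X Y) {c d : K.dom.Obj}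
    (g : K.dom.Vert c d) (u : X.left ⟶ K.ob c) (v : Y.left ⟶ K.ob d)
    (e : u ≫ K.ver g = ℓ.arr.left ≫ v) : ∃! w, ℓ.IsFillerVia g u v w := by
  obtain ⟨⟨d', p⟩, rfl⟩ : ∃ y, (K.slice A).ob y = Y :=
    (DoubleOver.bijective_slice_ob hob A).surjective Y
  change K.ob d' ⟶ K.ob d at v
  obtain ⟨c', g', β, rfl, hp, hβ⟩ := hK g v
  have e' : hp.lift u ℓ.arr.left e ≫ K.ver g' = ℓ.arr.left := hp.lift_snd _ _ _
  let G : SliceVert (J := K) (A := A) ⟨c', K.ver g' ≫ p⟩ ⟨d', p⟩ := .ofTarget g' p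
  let u₀ : X ⟶ (K.slice A).ob ⟨c', K.ver g' ≫ p⟩ := Over.homMk (hp.lift u ℓ.arr.left e)
    (((Category.assoc _ _ _).symm.trans (congrArg (· ≫ p) e')).trans (Over.w ℓ.arr))
  have e₀ : u₀ ≫ (K.slice A).ver G = ℓ.arr ≫ 𝟙 _ :=
    Over.OverMorphism.ext (e'.trans (Category.comp_id _).symm)
  refine ⟨(ℓ.lift G u₀ (𝟙 _) e₀).left ≫ K.hor (K.dom.top β),
    ⟨⟨_, _, G⟩, β, u₀, 𝟙 _, e₀, hp.lift_fst _ _ _, Category.id_comp _, rfl⟩, ?_⟩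
  rintro _ ⟨⟨⟨c₁, q⟩, ⟨d₁, r⟩, ⟨g₁, hg₁⟩⟩, γ, u', v', i, hu, hv, rfl⟩
  -- Both lifting problems receive a square from the one against the pullback of `g₁` along `v'`.
  change K.dom.Vert c₁ d₁ at g₁
  change K.ver g₁ ≫ r = q at hg₁
  change (⟨c₁, d₁, g₁⟩ : VertArrow K.dom.Vert) ⟶ ⟨c, d, g⟩ at γ
  have hr : v'.left ≫ r = p := Over.w v'
  have i' : u'.left ≫ K.ver g₁ = ℓ.arr.left ≫ v'.left := congrArg Over.Hom.left i
  obtain ⟨c₂, g₂, δ, hδ, hp₂, -⟩ := hK (d' := d') g₁ v'.left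
  obtain ⟨ε, hε, hε'⟩ := hβ ⟨c₂, d', g₂⟩ (δ ≫ γ)
    (hp.lift (K.hor (K.dom.top (δ ≫ γ))) (K.ver g₂) (by
      rw [K.sq_comm (δ ≫ γ), K.dom.bot_comp, K.hor_comp, hδ]
      exact congrArg (K.ver g₂ ≫ ·) hv)) (𝟙 _) (hp.lift_fst _ _ _)
    (by rw [Category.id_comp, K.dom.bot_comp, K.hor_comp, hδ]; exact hv.symm)
    ((hp.lift_snd _ _ _).trans (Category.comp_id _).symm)
  have hε₁ : K.hor (K.dom.top ε) ≫ K.hor (K.dom.top β) = K.hor (K.dom.top (δ ≫ γ)) := by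
    rw [hε, hp.lift_fst]
  have hε₂ : K.hor (K.dom.top ε) ≫ K.ver g' = K.ver g₂ := by rw [hε, hp.lift_snd]
  have e'' : hp₂.lift u'.left ℓ.arr.left i' ≫ K.ver g₂ = ℓ.arr.left := hp₂.lift_snd _ _ _
  let y₂ : VertArrow (K.slice A).dom.Vert :=
    ⟨⟨c₂, K.ver g₂ ≫ p⟩, ⟨d', p⟩, SliceVert.ofTarget g₂ p⟩
  let u₂ : X ⟶ (K.slice A).ob y₂.src := Over.homMk (hp₂.lift u'.left ℓ.arr.left i')
    (((Category.assoc _ _ _).symm.trans (congrArg (· ≫ p) e'')).trans (Over.w ℓ.arr))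
  have e₂ : u₂ ≫ (K.slice A).ver y₂.arr = ℓ.arr ≫ 𝟙 _ :=
    Over.OverMorphism.ext (e''.trans (Category.comp_id _).symm)
  have hq : K.hor (K.dom.top δ) ≫ q = K.ver g₂ ≫ p :=
    calc K.hor (K.dom.top δ) ≫ q = (K.hor (K.dom.top δ) ≫ K.ver g₁) ≫ r := by
          rw [Category.assoc]; exact congrArg _ hg₁.symm
      _ = K.ver g₂ ≫ p := by rw [K.sq_comm δ, Category.assoc, hδ, hr]
  have h₁ := ℓ.lift_left_natural (y := y₂) (y' := ⟨⟨c₁, q⟩, ⟨d₁, r⟩, ⟨g₁, hg₁⟩⟩)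
    (SliceSq.mk δ hq (by rw [hδ]; exact hr)) e₂ i
    (hp₂.lift_fst _ _ _) ((Category.id_comp _).trans hδ)
  have h₂ := ℓ.lift_left_natural (y := y₂) (y' := ⟨_, _, G⟩)
    (SliceSq.mk ε (by
      change K.hor _ ≫ K.ver g' ≫ p = K.ver g₂ ≫ p
      rw [← Category.assoc, hε₂])
      (by rw [hε']; exact Category.id_comp _)) e₂ e₀
    (hp.hom_ext
      (by
        rw [Category.assoc, hε₁, K.dom.top_comp, K.hor_comp, ← Category.assoc]
        exact ((congrArg (· ≫ _) (hp₂.lift_fst _ _ _)).trans hu).trans (hp.lift_fst _ _ _).symm)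
      (by
        rw [Category.assoc, hε₂]
        exact e''.trans e'.symm))
    ((Category.id_comp _).trans hε')
  refine (congrArg (· ≫ _) h₁).trans (Eq.trans ?_ (congrArg (· ≫ _) h₂).symm)
  dsimp only
  rw [Category.assoc, Category.assoc, hε₁, K.dom.top_comp, K.hor_comp]

/-- The fillers of a lifting operation against `K` are recovered from its restriction to `K / A`. -/
theorem LeftLift.isFillerVia_slice (hK : K.HasPullbackSquares) (hob : Function.Bijective K.ob)
    {X Y : Over A} (r : LeftLift K X.left Y.left) (hr : r.arr ≫ Y.hom = X.hom) {c d : K.dom.Obj}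
    (g : K.dom.Vert c d) (u : X.left ⟶ K.ob c) (v : Y.left ⟶ K.ob d)
    (e : u ≫ K.ver g = r.arr ≫ v) : (r.slice hr).IsFillerVia g u v (r.lift g u v e) := by
  obtain ⟨_, y, β, u', v', i, rfl, rfl, rfl⟩ :=
    ((r.slice hr).existsUnique_isFillerVia hK hob g u v e).exists
  exact ⟨y, β, u', v', i, rfl, rfl, (r.natural β u'.left v'.left (congrArg Over.Hom.left i)).symm⟩

/-- The fillers in the sense of `IsFillerVia` are compatible with vertical composition: `g` is
pulled back to a morphism over `A` with target `Y`, and `g'` is pulled back to the source of the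
result. -/
theorem LeftLift.exists_isFillerVia_vcomp (hK : K.HasPullbackSquares)
    (hob : Function.Bijective K.ob)
    (hhor : ∀ a b : K.dom.Obj, Function.Bijective (K.hor : (a ⟶ b) → _)) {X Y : Over A}
    (ℓ : LeftLift (K.slice A) X Y) {a b c : K.dom.Obj} (g' : K.dom.Vert a b) (g : K.dom.Vert b c)
    (u : X.left ⟶ K.ob a) (v : Y.left ⟶ K.ob c)
    (i : u ≫ K.ver (K.dom.vcomp g' g) = ℓ.arr.left ≫ v) :
    ∃ w' w, ℓ.IsFillerVia g (u ≫ K.ver g') v w' ∧ ℓ.IsFillerVia g' u w' w ∧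
      ℓ.IsFillerVia (K.dom.vcomp g' g) u v w := by
  obtain ⟨⟨c₁, p⟩, rfl⟩ : ∃ y, (K.slice A).ob y = Y :=
    (DoubleOver.bijective_slice_ob hob A).surjective Y
  change K.ob c₁ ⟶ K.ob c at v
  obtain ⟨b₁, g₁, β, rfl, hp, -⟩ := hK g v
  obtain ⟨a₁, g₁', β', hβ, hp', -⟩ := hK g' (K.hor (K.dom.top β))
  obtain hββ : K.dom.bot β' = K.dom.top β := (hhor _ _).injective hβ
  rw [K.ver_vcomp, ← Category.assoc] at i
  have i' : u ≫ K.ver g' = hp.lift (u ≫ K.ver g') ℓ.arr.left i ≫ K.hor (K.dom.top β) :=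
    (hp.lift_fst _ _ _).symm
  have h₁ : hp.lift (u ≫ K.ver g') ℓ.arr.left i ≫ K.ver g₁ = ℓ.arr.left := hp.lift_snd _ _ _
  have h₂ : hp'.lift u _ i' ≫ K.ver g₁' = hp.lift (u ≫ K.ver g') ℓ.arr.left i := hp'.lift_snd _ _ _
  have h₃ : hp'.lift u _ i' ≫ K.hor (K.dom.top β') = u := hp'.lift_fst _ _ _
  let G : SliceVert (J := K) (A := A) ⟨b₁, K.ver g₁ ≫ p⟩ ⟨c₁, p⟩ := .ofTarget g₁ p
  let G' : SliceVert (J := K) (A := A) ⟨a₁, K.ver g₁' ≫ K.ver g₁ ≫ p⟩ ⟨b₁, K.ver g₁ ≫ p⟩ :=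
    .ofTarget g₁' _
  let u₀ : X ⟶ (K.slice A).ob ⟨a₁, K.ver g₁' ≫ K.ver g₁ ≫ p⟩ :=
    Over.homMk (hp'.lift u _ i') (by
      change _ ≫ K.ver g₁' ≫ K.ver g₁ ≫ p = _
      rw [reassoc_of% h₂, reassoc_of% h₁]
      exact Over.w ℓ.arr)
  have e₁ : (u₀ ≫ (K.slice A).ver G') ≫ (K.slice A).ver G = ℓ.arr ≫ 𝟙 _ :=
    Over.OverMorphism.ext (by
      change (hp'.lift u _ i' ≫ K.ver g₁') ≫ K.ver g₁ = ℓ.arr.left ≫ 𝟙 _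
      rw [h₂, h₁, Category.comp_id])
  have e₂ : u₀ ≫ (K.slice A).ver ((K.slice A).dom.vcomp G' G) = ℓ.arr ≫ 𝟙 _ := by
    rw [(K.slice A).ver_vcomp, ← Category.assoc, e₁]
  refine ⟨(ℓ.lift G (u₀ ≫ (K.slice A).ver G') (𝟙 _) e₁).left ≫ K.hor (K.dom.top β),
    (ℓ.lift ((K.slice A).dom.vcomp G' G) u₀ (𝟙 _) e₂).left ≫ K.hor (K.dom.top β'),
    ⟨⟨_, _, G⟩, β, _, _, e₁, ?_, Category.id_comp _, rfl⟩,
    ⟨⟨_, _, G'⟩, β', u₀, ℓ.lift G (u₀ ≫ (K.slice A).ver G') (𝟙 _) e₁, (ℓ.fac_left _ _ _ _).symm,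
      h₃, by rw [hβ], by rw [ℓ.lift_vcomp]⟩,
    ⟨⟨_, _, (K.slice A).dom.vcomp G' G⟩, K.dom.vcompSq β' β hββ, u₀, 𝟙 _, e₂, ?_, ?_, ?_⟩⟩
  · change (hp'.lift u _ i' ≫ K.ver g₁') ≫ _ = _
    rw [h₂]
    exact i'.symm
  · rw [K.dom.top_vcompSq]; exact h₃
  · rw [K.dom.bot_vcompSq]; exact Category.id_comp _
  · rw [K.dom.top_vcompSq]

theorem LeftLift.slice_injective (hK : K.HasPullbackSquares) (hob : Function.Bijective K.ob)
    {X Y : Over A} {r r' : LeftLift K X.left Y.left} {hr : r.arr ≫ Y.hom = X.hom}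
    {hr' : r'.arr ≫ Y.hom = X.hom} (h : r.slice hr = r'.slice hr') : r = r' := by
  have ha : r.arr = r'.arr := congrArg (fun t => t.arr.left) h
  refine LeftLift.ext_lift ha fun {c d} g u v e e' => ?_
  exact ((r.slice hr).existsUnique_isFillerVia hK hob g u v e).unique
    (r.isFillerVia_slice hK hob hr g u v e) (h ▸ r'.isFillerVia_slice hK hob hr' g u v e')

/-- Lifting operations against `K / A` come from lifting operations against `K`. -/
theorem LeftLift.exists_slice_eq (hK : K.HasPullbackSquares) (hob : Function.Bijective K.ob)
    (hhor : ∀ a b : K.dom.Obj, Function.Bijective (K.hor : (a ⟶ b) → _)) {X Y : Over A}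
    (ℓ : LeftLift (K.slice A) X Y) :
    ∃ (r : LeftLift K X.left Y.left) (hr : r.arr ≫ Y.hom = X.hom), r.slice hr = ℓ := by
  choose L hL hL' using fun {c d : K.dom.Obj} (g : K.dom.Vert c d) (u : X.left ⟶ K.ob c)
    (v : Y.left ⟶ K.ob d) (e : u ≫ K.ver g = ℓ.arr.left ≫ v) =>
    ℓ.existsUnique_isFillerVia hK hob g u v e
  refine ⟨{
    arr := ℓ.arr.left
    lift := fun g u v e => L g u v e
    fac_left := fun g u v e => (hL g u v e).fac_left
    fac_right := fun g u v e => (hL g u v e).fac_right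
    natural := fun β u v e => (hL' _ _ _ _ _ ((hL _ u v e).comp β)).symm
    lift_vcomp := ?_ }, Over.w ℓ.arr, ?_⟩
  · intro c d e g' g u v i
    obtain ⟨w', w, h₁, h₂, h₃⟩ := ℓ.exists_isFillerVia_vcomp hK hob hhor g' g u v i
    obtain rfl := hL' _ _ _ (by rw [← i, K.ver_vcomp, Category.assoc]) _ h₁
    exact (hL' _ _ _ _ _ h₃).symm.trans (hL' _ _ _ _ _ h₂)
  · exact LeftLift.ext_lift rfl fun g u v e e' => Over.OverMorphism.ext
      (hL' g.vert u.left v.left _ _ (ℓ.isFillerVia_of_slice g u v e')).symm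

/-- A square over `A` that commutes with the lifting operations against `K / A` commutes with those
against `K`. -/
theorem LeftLiftHom.lift_comm_of_slice (hK : K.HasPullbackSquares)
    (hob : Function.Bijective K.ob) {X Y X' Y' : Over A} {r : LeftLift K X.left Y.left}
    {hr : r.arr ≫ Y.hom = X.hom} {r' : LeftLift K X'.left Y'.left}
    {hr' : r'.arr ≫ Y'.hom = X'.hom}
    (α : LeftLiftHom (K.slice A) ⟨X, Y, r.slice hr⟩ ⟨X', Y', r'.slice hr'⟩) {c d : K.dom.Obj}
    (g : K.dom.Vert c d) (u : X'.left ⟶ K.ob c) (v : Y'.left ⟶ K.ob d)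
    (e : u ≫ K.ver g = r'.arr ≫ v)
    (e' : (α.top.left ≫ u) ≫ K.ver g = r.arr ≫ α.bot.left ≫ v) :
    r.lift g (α.top.left ≫ u) (α.bot.left ≫ v) e' = α.bot.left ≫ r'.lift g u v e := by
  obtain ⟨_, y, β, u', v', i, rfl, rfl, rfl⟩ :=
    ((r'.slice hr').existsUnique_isFillerVia hK hob g u v e).exists
  have hc : α.top ≫ (r'.slice hr').arr = (r.slice hr).arr ≫ α.bot := α.comm
  have i₁ : (α.top ≫ u') ≫ (K.slice A).ver y.arr = (r.slice hr).arr ≫ α.bot ≫ v' := by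
    rw [Category.assoc, i, reassoc_of% hc]
  have h := congrArg Over.Hom.left (α.lift_comm y.arr u' v' i)
  have h₁ := r.natural β (α.top ≫ u').left (α.bot ≫ v').left (congrArg Over.Hom.left i₁)
  have h₂ := r'.natural β u'.left v'.left (congrArg Over.Hom.left i)
  refine Eq.trans ?_ ((h₁.trans (congrArg (· ≫ _) h)).trans
    ((Category.assoc _ _ _).trans (congrArg (α.bot.left ≫ ·) h₂.symm)))
  congr 1 <;> exact (Category.assoc _ _ _).symm

/-- If `K` has pullback squares and `J` is the left dual of `K`, then `J / A` is the left dual of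
`K / A`. -/
theorem LiftingOperation.isBijective_toLeftDual_slice {φ : LiftingOperation J K}
    (h : φ.toLeftDual.IsBijective) (hK : K.HasPullbackSquares) (hob : Function.Bijective K.ob)
    (hhor : ∀ a b : K.dom.Obj, Function.Bijective (K.hor : (a ⟶ b) → _)) (A : C) :
    (φ.slice A).toLeftDual.IsBijective where
  obj := DoubleOver.bijective_slice_ob h.obj A
  map := DoubleOver.bijective_slice_hor h.map
  vert x y := by
    refine ⟨fun g g' e => SliceVert.ext ((h.vert _ _).injective ?_), fun ℓ => ?_⟩
    · exact LeftLift.slice_injective hK hob (X := (J.slice A).ob x) (Y := (J.slice A).ob y)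
        (r := φ.leftLift g.vert) (r' := φ.leftLift g'.vert) (hr := g.isOver)
        (hr' := g'.isOver) e
    · obtain ⟨r, hr, rfl⟩ := LeftLift.exists_slice_eq hK hob hhor (X := (J.slice A).ob x)
        (Y := (J.slice A).ob y) ℓ
      obtain ⟨g, rfl⟩ := (h.vert x.pt y.pt).surjective r
      exact ⟨⟨g, hr⟩, rfl⟩
  sq x y := by
    refine ⟨fun α β e => SliceSq.ext ((h.sq _ _).injective ?_), fun α => ?_⟩
    · exact LeftLiftHom.ext (congrArg (fun t => t.top.left) e) (congrArg (fun t => t.bot.left) e)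
    · obtain ⟨β, hβ⟩ := (h.sq ⟨_, _, x.arr.vert⟩ ⟨_, _, y.arr.vert⟩).surjective
        (LeftLiftHom.mk α.top.left α.bot.left (congrArg Over.Hom.left α.comm)
          fun g u v e => LeftLiftHom.lift_comm_of_slice hK hob
            (X := (J.slice A).ob x.src) (Y := (J.slice A).ob x.tgt)
            (X' := (J.slice A).ob y.src) (Y' := (J.slice A).ob y.tgt)
            (r := φ.leftLift x.arr.vert) (r' := φ.leftLift y.arr.vert)
            (hr := x.arr.isOver) (hr' := y.arr.isOver) α g u v e _)
      have ht : J.hor (J.dom.top β) = α.top.left := congrArg LeftLiftHom.top hβ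
      have hb : J.hor (J.dom.bot β) = α.bot.left := congrArg LeftLiftHom.bot hβ
      exact ⟨⟨β, by rw [ht]; exact Over.w α.top, by rw [hb]; exact Over.w α.bot⟩,
        LeftLiftHom.ext (Over.OverMorphism.ext ht) (Over.OverMorphism.ext hb)⟩

end Left

/-! ### Lifting operations as double functors into the duals -/

section Represent

variable {C : Type u} [Category.{v} C] {J : DoubleOver.{v, u, o₁, h₁, w₁, s₁} C}
  {K : DoubleOver.{v, u, o₂, h₂, w₂, s₂} C}

theorem DoubleFunctor.vert_congr {D : DoubleCategory.{o₁, h₁, w₁, s₁}}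
    {E : DoubleCategory.{o₂, h₂, w₂, s₂}} {F G : DoubleFunctor D E} (h : F = G) {a b : D.Obj}
    (f : D.Vert a b) : HEq (F.vert f) (G.vert f) := by
  subst h; rfl

theorem LeftLift.lift_congr {X Y : C} {r r' : LeftLift K X Y} (h : r = r') {c d : K.dom.Obj}
    (g : K.dom.Vert c d) (u : X ⟶ K.ob c) (v : Y ⟶ K.ob d) (e : u ≫ K.ver g = r.arr ≫ v) :
    r.lift g u v e = r'.lift g u v (h ▸ e) := by
  subst h; rfl

theorem RightLift.lift_congr {X Y : C} {r r' : RightLift J X Y} (h : r = r') {a b : J.dom.Obj}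
    (f : J.dom.Vert a b) (u : J.ob a ⟶ X) (v : J.ob b ⟶ Y) (e : u ≫ r.arr = J.ver f ≫ v) :
    r.lift f u v e = r'.lift f u v (h ▸ e) := by
  subst h; rfl

theorem LiftingOperation.toLeftDual_injective :
    Function.Injective (LiftingOperation.toLeftDual (J := J) (K := K)) := by
  intro θ θ' h
  refine LiftingOperation.ext ?_
  funext a b f c d g u v e
  exact LeftLift.lift_congr (eq_of_heq (DoubleFunctor.vert_congr h f) :
    θ.leftLift f = θ'.leftLift f) g u v e

theorem LiftingOperation.toRightDual_injective :
    Function.Injective (LiftingOperation.toRightDual (J := J) (K := K)) := by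
  intro θ θ' h
  refine LiftingOperation.ext ?_
  funext a b f c d g u v e
  exact RightLift.lift_congr (eq_of_heq (DoubleFunctor.vert_congr h g) :
    θ.rightLift g = θ'.rightLift g) f u v e

/-- The boundary of the image of a square under a double functor is only propositionally the image
of its boundary, so that `lift_comm` is needed for horizontal morphisms that are equal to `α.top` and
`α.bot`. -/
theorem LeftLiftHom.lift_comm_of_eq {x y : VertArrow (LeftLift K)} (α : LeftLiftHom K x y)
    {t : x.src ⟶ y.src} {b : x.tgt ⟶ y.tgt} (ht : α.top = t) (hb : α.bot = b) {c d : K.dom.Obj}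
    (g : K.dom.Vert c d) (u : y.src ⟶ K.ob c) (v : y.tgt ⟶ K.ob d)
    (e : u ≫ K.ver g = y.arr.arr ≫ v) (e' : (t ≫ u) ≫ K.ver g = x.arr.arr ≫ b ≫ v) :
    x.arr.lift g (t ≫ u) (b ≫ v) e' = b ≫ y.arr.lift g u v e := by
  subst ht hb
  exact α.lift_comm g u v e

theorem RightLiftHom.lift_comm_of_eq {x y : VertArrow (RightLift J)} (β : RightLiftHom J x y)
    {t : x.src ⟶ y.src} {b : x.tgt ⟶ y.tgt} (ht : β.top = t) (hb : β.bot = b) {a a' : J.dom.Obj}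
    (f : J.dom.Vert a a') (u : J.ob a ⟶ x.src) (v : J.ob a' ⟶ x.tgt)
    (e : u ≫ x.arr.arr = J.ver f ≫ v) (e' : (u ≫ t) ≫ y.arr.arr = J.ver f ≫ v ≫ b) :
    y.arr.lift f (u ≫ t) (v ≫ b) e' = x.arr.lift f u v e ≫ t := by
  subst ht hb
  exact β.lift_comm f u v e

theorem LiftingOperation.lift_congr (θ : LiftingOperation J K) {a b : J.dom.Obj}
    (f : J.dom.Vert a b) {c d : K.dom.Obj} (g : K.dom.Vert c d) {u u' : J.ob a ⟶ K.ob c}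
    {v v' : J.ob b ⟶ K.ob d} (hu : u = u') (hv : v = v') (e : u ≫ K.ver g = J.ver f ≫ v) :
    θ.lift f g u v e = θ.lift f g u' v' (hu ▸ hv ▸ e) := by
  subst hu hv; rfl

theorem LiftingOperation.toLeftDual_comp_toSq (θ : LiftingOperation J K) :
    θ.toLeftDual.comp (leftDual K).toSq = J.toSq :=
  DoubleFunctor.ext rfl HEq.rfl (heq_of_eq (by
    funext x y α
    exact SqHom.ext (J.toSq.top_sq α).symm (J.toSq.bot_sq α).symm))

theorem LiftingOperation.toRightDual_comp_toSq (θ : LiftingOperation J K) :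
    θ.toRightDual.comp (rightDual J).toSq = K.toSq :=
  DoubleFunctor.ext rfl HEq.rfl (heq_of_eq (by
    funext x y α
    exact SqHom.ext (K.toSq.top_sq α).symm (K.toSq.bot_sq α).symm))

/-- Every double functor from `J` to the left dual of `K`, over the squares of `C`, is induced by a
lifting operation. -/
theorem LiftingOperation.exists_toLeftDual_eq (G : DoubleFunctor J.dom (leftDual K).dom)
    (h : G.comp (leftDual K).toSq = J.toSq) : ∃ θ : LiftingOperation J K, θ.toLeftDual = G := by
  obtain ⟨D, T⟩ := J
  dsimp only at G h
  subst h
  refine ⟨{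
    lift := fun {_ _} f {_ _} g u v e => LeftLift.lift (G.vert f) g u v e
    fac_left := fun {_ _} f {_ _} g u v e => LeftLift.fac_left (G.vert f) g u v e
    fac_right := fun {_ _} f {_ _} g u v e => LeftLift.fac_right (G.vert f) g u v e
    natural := ?_
    lift_vcomp_left := ?_
    lift_vcomp_right := fun {_ _} f {_ _ _} g' g u v i =>
      LeftLift.lift_vcomp (G.vert f) g' g u v i }, ?_⟩
  · intro x' x α y y' β u v e
    have e' : (u ≫ K.hor (K.dom.top β)) ≫ K.ver y'.arr =
        LeftLift.arr (G.vert x.arr) ≫ v ≫ K.hor (K.dom.bot β) := by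
      rw [Category.assoc, K.sq_comm β]
      exact (reassoc_of% e) _
    exact (LeftLiftHom.lift_comm_of_eq (G.sq α) (G.top_sq α) (G.bot_sq α) y'.arr _ _ e' _).trans
      (congrArg (G.hor.map (D.bot α) ≫ ·) (LeftLift.natural (G.vert x.arr) β u v e))
  · intro a b c f' f d e g u v i
    exact LeftLift.lift_congr (G.vert_vcomp f' f) g u v i
  · exact DoubleFunctor.ext rfl HEq.rfl (heq_of_eq (by
      funext x y α
      exact LeftLiftHom.ext (x := ⟨_, _, G.vert x.arr⟩) (y := ⟨_, _, G.vert y.arr⟩)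
        (G.top_sq α).symm (G.bot_sq α).symm))

/-- Every double functor from `K` to the right dual of `J`, over the squares of `C`, is induced by a
lifting operation. -/
theorem LiftingOperation.exists_toRightDual_eq (G : DoubleFunctor K.dom (rightDual J).dom)
    (h : G.comp (rightDual J).toSq = K.toSq) : ∃ θ : LiftingOperation J K, θ.toRightDual = G := by
  obtain ⟨D, T⟩ := K
  dsimp only at G h
  subst h
  -- `K` again denotes the double category over the squares of `C`, now with the composite of `G`.
  let K : DoubleOver C := ⟨D, G.comp (rightDual J).toSq⟩
  refine ⟨{
    lift := fun {_ _} f {_ _} g u v e => RightLift.lift (G.vert g) f u v e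
    fac_left := fun {_ _} f {_ _} g u v e => RightLift.fac_left (G.vert g) f u v e
    fac_right := fun {_ _} f {_ _} g u v e => RightLift.fac_right (G.vert g) f u v e
    natural := ?_
    lift_vcomp_left := fun {_ _ _} f' f {_ _} g u v i => RightLift.lift_vcomp (G.vert g) f' f u v i
    lift_vcomp_right := ?_ }, ?_⟩
  · intro x' x α y y' β u v e
    have e' : (u ≫ K.hor (K.dom.top β)) ≫ RightLift.arr (G.vert y'.arr) =
        J.ver x.arr ≫ v ≫ K.hor (K.dom.bot β) :=
      ((Category.assoc _ _ _).trans (congrArg (u ≫ ·) (K.sq_comm β))).trans ((reassoc_of% e) _)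
    exact (RightLift.natural (G.vert y'.arr) α _ _ e').trans (congrArg (J.hor (J.dom.bot α) ≫ ·)
      (RightLiftHom.lift_comm_of_eq (G.sq β) (G.top_sq β) (G.bot_sq β) x.arr u v e e'))
  · intro a b f c d e g' g u v i
    exact RightLift.lift_congr (G.vert_vcomp g' g) f u v i
  · exact DoubleFunctor.ext rfl HEq.rfl (heq_of_eq (by
      funext x y α
      exact RightLiftHom.ext (x := ⟨_, _, G.vert x.arr⟩) (y := ⟨_, _, G.vert y.arr⟩)
        (G.top_sq α).symm (G.bot_sq α).symm))

end Represent

/-! ### Transposition of lifting operations along an adjunction -/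

section Transpose

variable {C : Type u₁} [Category.{v₁} C] {D : Type u₂} [Category.{v₂} D]

/-- The double category `J` over the squares of `C`, regarded as one over the squares of `D` by
means of a functor `H : C ⥤ D`. -/
abbrev DoubleOver.map (J : DoubleOver.{v₁, u₁, o₁, h₁, w₁, s₁} C) (H : C ⥤ D) :
    DoubleOver.{v₂, u₂, o₁, h₁, w₁, s₁} D :=
  ⟨J.dom, J.toSq.comp (Sq.map H)⟩

variable {L : C ⥤ D} {R : D ⥤ C} (adj : L ⊣ R) {J : DoubleOver.{v₁, u₁, o₁, h₁, w₁, s₁} C}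
  {K : DoubleOver.{v₂, u₂, o₂, h₂, w₂, s₂} D}

theorem transpose_symm_comm {X Y : C} {X' Y' : D} {f : X ⟶ Y} {g : X' ⟶ Y'}
    {u : X ⟶ R.obj X'} {v : Y ⟶ R.obj Y'} (e : u ≫ R.map g = f ≫ v) :
    (adj.homEquiv X X').symm u ≫ g = L.map f ≫ (adj.homEquiv Y Y').symm v := by
  rw [← adj.homEquiv_naturality_right_symm, e, adj.homEquiv_naturality_left_symm]

/-- Naturality of transposition in both variables at once. -/
theorem homEquiv_comp_comp {X Y : C} {Z W : D} (a : X ⟶ Y) (u : L.obj Y ⟶ Z) (b : Z ⟶ W) :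
    adj.homEquiv X W (L.map a ≫ u ≫ b) = a ≫ adj.homEquiv Y Z u ≫ R.map b := by
  rw [adj.homEquiv_naturality_left, adj.homEquiv_naturality_right]

theorem homEquiv_symm_comp_comp {X Y : C} {Z W : D} (a : X ⟶ Y) (u : Y ⟶ R.obj Z) (b : Z ⟶ W) :
    (adj.homEquiv X W).symm (a ≫ u ≫ R.map b) = L.map a ≫ (adj.homEquiv Y Z).symm u ≫ b := by
  rw [adj.homEquiv_naturality_left_symm, adj.homEquiv_naturality_right_symm]

/-- Transposition of fillers along an adjunction `L ⊣ R`. -/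
def LiftingOperation.transpose :
    LiftingOperation (J.map L) K ≃ LiftingOperation J (K.map R) where
  toFun θ :=
    { lift := fun {a b} f {c d} g u v e => adj.homEquiv (J.ob b) (K.ob c)
        (θ.lift f g ((adj.homEquiv (J.ob a) (K.ob c)).symm u)
          ((adj.homEquiv (J.ob b) (K.ob d)).symm v) (transpose_symm_comm adj e))
      fac_left := fun {_ _} f {_ _} g u v e => (adj.homEquiv_naturality_left _ _).symm.trans
        ((congrArg (adj.homEquiv _ _) (θ.fac_left f g _ _ _)).trans (Equiv.apply_symm_apply _ _))
      fac_right := fun {_ _} f {_ _} g u v e => (adj.homEquiv_naturality_right _ _).symm.trans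
        ((congrArg (adj.homEquiv _ _) (θ.fac_right f g _ _ _)).trans (Equiv.apply_symm_apply _ _))
      natural := fun {_ _} α {_ _} β u v e => (congrArg (adj.homEquiv _ _)
        ((θ.lift_congr _ _ (homEquiv_symm_comp_comp adj _ _ _) (homEquiv_symm_comp_comp adj _ _ _)
          _).trans (θ.natural α β _ _ (transpose_symm_comm adj e)))).trans
            (homEquiv_comp_comp adj _ _ _)
      lift_vcomp_left := fun {_ _ _} f' f {_ _} g u v i => congrArg (adj.homEquiv _ _)
        ((θ.lift_vcomp_left f' f g _ _ _).trans (θ.lift_congr _ _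
          ((θ.lift_congr _ _ rfl (adj.homEquiv_naturality_left_symm _ _).symm _).trans
            (Equiv.symm_apply_apply _ _).symm) rfl _))
      lift_vcomp_right := fun {_ _} f {_ _ _} g' g u v i => congrArg (adj.homEquiv _ _)
        ((θ.lift_vcomp_right f g' g _ _ _).trans (θ.lift_congr _ _ rfl
          ((θ.lift_congr _ _ (adj.homEquiv_naturality_right_symm _ _).symm rfl _).trans
            (Equiv.symm_apply_apply _ _).symm) _)) }
  invFun θ :=
    { lift := fun {a b} f {c d} g u v e => (adj.homEquiv (J.ob b) (K.ob c)).symm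
        (θ.lift f g (adj.homEquiv (J.ob a) (K.ob c) u)
          (adj.homEquiv (J.ob b) (K.ob d) v) (transpose_comm adj e))
      fac_left := fun {_ _} f {_ _} g u v e => (adj.homEquiv_naturality_left_symm _ _).symm.trans
        ((congrArg (adj.homEquiv _ _).symm (θ.fac_left f g _ _ _)).trans
          (Equiv.symm_apply_apply _ _))
      fac_right := fun {_ _} f {_ _} g u v e => (adj.homEquiv_naturality_right_symm _ _).symm.trans
        ((congrArg (adj.homEquiv _ _).symm (θ.fac_right f g _ _ _)).trans
          (Equiv.symm_apply_apply _ _))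
      natural := fun {_ _} α {_ _} β u v e => (congrArg (adj.homEquiv _ _).symm
        ((θ.lift_congr _ _ (homEquiv_comp_comp adj _ _ _) (homEquiv_comp_comp adj _ _ _)
          _).trans (θ.natural α β _ _ (transpose_comm adj e)))).trans
            (homEquiv_symm_comp_comp adj _ _ _)
      lift_vcomp_left := fun {_ _ _} f' f {_ _} g u v i => congrArg (adj.homEquiv _ _).symm
        ((θ.lift_vcomp_left f' f g _ _ _).trans (θ.lift_congr _ _
          ((θ.lift_congr _ _ rfl (adj.homEquiv_naturality_left _ _).symm _).trans
            (Equiv.apply_symm_apply _ _).symm) rfl _))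
      lift_vcomp_right := fun {_ _} f {_ _ _} g' g u v i => congrArg (adj.homEquiv _ _).symm
        ((θ.lift_vcomp_right f g' g _ _ _).trans (θ.lift_congr _ _ rfl
          ((θ.lift_congr _ _ (adj.homEquiv_naturality_right _ _).symm rfl _).trans
            (Equiv.apply_symm_apply _ _).symm) _)) }
  left_inv θ := by
    refine LiftingOperation.ext ?_
    funext a b f c d g u v e
    exact (Equiv.symm_apply_apply _ _).trans
      (θ.lift_congr _ _ (Equiv.symm_apply_apply _ _) (Equiv.symm_apply_apply _ _) _)
  right_inv θ := by
    refine LiftingOperation.ext ?_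
    funext a b f c d g u v e
    exact (Equiv.apply_symm_apply _ _).trans
      (θ.lift_congr _ _ (Equiv.apply_symm_apply _ _) (Equiv.apply_symm_apply _ _) _)

end Transpose

/-! ### Lifts of functors as lifting operations -/

section FunctorLift

variable {C : Type u₁} [Category.{v₁} C] {D : Type u₂} [Category.{v₂} D] {H : C ⥤ D}
  {J : DoubleOver.{v₁, u₁, o₁, h₁, w₁, s₁} C} {K : DoubleOver.{v₂, u₂, o₂, h₂, w₂, s₂} D}
  {M : DoubleOver.{v₂, u₂, o₃, h₃, w₃, s₃} D}

/-- If `K` is the left dual of `M`, then lifts of `H` to a double functor from `J` to `K` correspond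
to lifting operations against `M` of the images under `H` of the vertical morphisms of `J`. -/
theorem FunctorLift.exists_equiv_of_toLeftDual {ψ : LiftingOperation K M}
    (hψ : ψ.toLeftDual.IsBijective) :
    ∃ Ψ : FunctorLift H J K ≃ LiftingOperation (J.map H) M,
      ∀ F : FunctorLift H J K, (Ψ F).toLeftDual = F.functor.comp ψ.toLeftDual := by
  obtain ⟨G, hG, hG'⟩ := hψ.isInvertible
  choose Ψ hΨ using fun F : FunctorLift H J K =>
    LiftingOperation.exists_toLeftDual_eq (J := J.map H) (F.functor.comp ψ.toLeftDual)
      ((congrArg F.functor.comp ψ.toLeftDual_comp_toSq).trans F.comm)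
  refine ⟨⟨Ψ, fun θ => ⟨θ.toLeftDual.comp G, ?_⟩, fun F => ?_, fun θ => ?_⟩, hΨ⟩
  · rw [← ψ.toLeftDual_comp_toSq]
    calc (θ.toLeftDual.comp G).comp (ψ.toLeftDual.comp (leftDual M).toSq)
        = (θ.toLeftDual.comp (G.comp ψ.toLeftDual)).comp (leftDual M).toSq := rfl
      _ = (J.map H).toSq := by rw [hG']; exact θ.toLeftDual_comp_toSq
  · refine FunctorLift.ext ?_
    dsimp only
    rw [hΨ]
    calc (F.functor.comp ψ.toLeftDual).comp G = F.functor.comp (ψ.toLeftDual.comp G) := rfl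
      _ = F.functor := by rw [hG]; rfl
  · refine LiftingOperation.toLeftDual_injective ?_
    rw [hΨ]
    calc θ.toLeftDual.comp (G.comp ψ.toLeftDual) = θ.toLeftDual := by rw [hG']; rfl

/-- If `K` is the right dual of `M`, then lifts of `H` to a double functor from `J` to `K`
correspond to lifting operations of `M` against the images under `H` of the vertical morphisms of
`J`. -/
theorem FunctorLift.exists_equiv_of_toRightDual {ψ : LiftingOperation M K}
    (hψ : ψ.toRightDual.IsBijective) :
    ∃ Ψ : FunctorLift H J K ≃ LiftingOperation M (J.map H),
      ∀ F : FunctorLift H J K, (Ψ F).toRightDual = F.functor.comp ψ.toRightDual := by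
  obtain ⟨G, hG, hG'⟩ := hψ.isInvertible
  choose Ψ hΨ using fun F : FunctorLift H J K =>
    LiftingOperation.exists_toRightDual_eq (K := J.map H) (F.functor.comp ψ.toRightDual)
      ((congrArg F.functor.comp ψ.toRightDual_comp_toSq).trans F.comm)
  refine ⟨⟨Ψ, fun θ => ⟨θ.toRightDual.comp G, ?_⟩, fun F => ?_, fun θ => ?_⟩, hΨ⟩
  · rw [← ψ.toRightDual_comp_toSq]
    calc (θ.toRightDual.comp G).comp (ψ.toRightDual.comp (rightDual M).toSq)
        = (θ.toRightDual.comp (G.comp ψ.toRightDual)).comp (rightDual M).toSq := rfl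
      _ = (J.map H).toSq := by rw [hG']; exact θ.toRightDual_comp_toSq
  · refine FunctorLift.ext ?_
    dsimp only
    rw [hΨ]
    calc (F.functor.comp ψ.toRightDual).comp G = F.functor.comp (ψ.toRightDual.comp G) := rfl
      _ = F.functor := by rw [hG]; rfl
  · refine LiftingOperation.toRightDual_injective ?_
    rw [hΨ]
    calc θ.toRightDual.comp (G.comp ψ.toRightDual) = θ.toRightDual := by rw [hG']; rfl

/-- The lifting operation that corresponds to a lift `F` of `H` consists of the fillers
`F.solveLeft`. -/
theorem FunctorLift.solveLeft_eq (F : FunctorLift H J K) (ψ : LiftingOperation K M)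
    (θ : LiftingOperation (J.map H) M) (hθ : θ.toLeftDual = F.functor.comp ψ.toLeftDual)
    {a b : J.dom.Obj} (f : J.dom.Vert a b) {c d : M.dom.Obj} (g : M.dom.Vert c d)
    (u : H.obj (J.ob a) ⟶ M.ob c) (v : H.obj (J.ob b) ⟶ M.ob d)
    (e : u ≫ M.ver g = H.map (J.ver f) ≫ v) :
    F.solveLeft ψ f g u v e = θ.lift f g u v e := by
  -- With a variable `T` in place of `J.toSq.comp (Sq.map H)`, the equation `F.comm` can be
  -- eliminated, and the morphisms `eqToHom _` become identities.
  have key : ∀ (T : DoubleFunctor J.dom (Sq D)) (_ : F.functor.comp K.toSq = T)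
      (θ : LiftingOperation ⟨J.dom, T⟩ M), θ.toLeftDual = F.functor.comp ψ.toLeftDual →
      ∀ (ha : K.ob (F.functor.hor.obj a) = T.hor.obj a)
        (hb : K.ob (F.functor.hor.obj b) = T.hor.obj b)
        (u : T.hor.obj a ⟶ M.ob c) (v : T.hor.obj b ⟶ M.ob d)
        (e : u ≫ M.ver g = T.vert f ≫ v) (e'),
        eqToHom hb.symm ≫ ψ.lift (F.functor.vert f) g (eqToHom ha ≫ u) (eqToHom hb ≫ v) e' =
          θ.lift f g u v e := by
    rintro _ rfl θ hθ ha hb u v e e'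
    have h := LeftLift.lift_congr (eq_of_heq (DoubleFunctor.vert_congr hθ f) :
      θ.leftLift f = ψ.leftLift (F.functor.vert f)) g u v e
    refine Eq.trans ?_ h.symm
    exact (Category.id_comp _).trans
      (ψ.lift_congr _ _ (Category.id_comp _) (Category.id_comp _) _)
  exact key _ F.comm θ hθ (F.ob_eq a) (F.ob_eq b) u v e _

/-- The lifting operation that corresponds to a lift `F` of `H` consists of the fillers
`F.solveRight`. -/
theorem FunctorLift.solveRight_eq (F : FunctorLift H J K) (ψ : LiftingOperation M K)
    (θ : LiftingOperation M (J.map H)) (hθ : θ.toRightDual = F.functor.comp ψ.toRightDual)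
    {c d : M.dom.Obj} (f : M.dom.Vert c d) {a b : J.dom.Obj} (g : J.dom.Vert a b)
    (u : M.ob c ⟶ H.obj (J.ob a)) (v : M.ob d ⟶ H.obj (J.ob b))
    (e : u ≫ H.map (J.ver g) = M.ver f ≫ v) :
    F.solveRight ψ f g u v e = θ.lift f g u v e := by
  -- With a variable `T` in place of `J.toSq.comp (Sq.map H)`, the equation `F.comm` can be
  -- eliminated, and the morphisms `eqToHom _` become identities.
  have key : ∀ (T : DoubleFunctor J.dom (Sq D)) (_ : F.functor.comp K.toSq = T)
      (θ : LiftingOperation M ⟨J.dom, T⟩), θ.toRightDual = F.functor.comp ψ.toRightDual →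
      ∀ (ha : K.ob (F.functor.hor.obj a) = T.hor.obj a)
        (hb : K.ob (F.functor.hor.obj b) = T.hor.obj b)
        (u : M.ob c ⟶ T.hor.obj a) (v : M.ob d ⟶ T.hor.obj b)
        (e : u ≫ T.vert g = M.ver f ≫ v) (e'),
        ψ.lift f (F.functor.vert g) (u ≫ eqToHom ha.symm) (v ≫ eqToHom hb.symm) e' ≫ eqToHom ha =
          θ.lift f g u v e := by
    rintro _ rfl θ hθ ha hb u v e e'
    have h := RightLift.lift_congr (eq_of_heq (DoubleFunctor.vert_congr hθ g) :
      θ.rightLift g = ψ.rightLift (F.functor.vert g)) f u v e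
    refine Eq.trans ?_ h.symm
    exact (Category.comp_id _).trans
      (ψ.lift_congr _ _ (Category.comp_id _) (Category.comp_id _) _)
  exact key _ F.comm θ hθ (F.ob_eq a) (F.ob_eq b) u v e _

end FunctorLift

end DoubleLifting

theorem theorem5 {C : Type u} [Category.{v} C] [HasPullbacks C]
    (J : DoubleLifting.DoubleOver.{v, u, o₁, h₁, w₁, s₁} C)
    (K : DoubleLifting.DoubleOver.{v, u, o₂, h₂, w₂, s₂} C)
    (φ : DoubleLifting.LiftingOperation J K) (hφ : φ.IsClosed)
    {A B : C} (f : A ⟶ B) [ChosenPullbacksAlong f] [ExponentiableMorphism f] :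
    ∃ Φ : DoubleLifting.FrobeniusStructure J f ≃ DoubleLifting.PushforwardStructure K f,
      ∀ (F : DoubleLifting.FrobeniusStructure J f)
        {b b' : (J.slice B).dom.Obj} (j : (J.slice B).dom.Vert b b')
        {a a' : (K.slice A).dom.Obj} (k : (K.slice A).dom.Vert a a')
        (u : (ChosenPullbacksAlong.pullback f).obj ((J.slice B).ob b) ⟶ (K.slice A).ob a)
        (v : (ChosenPullbacksAlong.pullback f).obj ((J.slice B).ob b') ⟶ (K.slice A).ob a')
        (e : u ≫ (K.slice A).ver k =
          (ChosenPullbacksAlong.pullback f).map ((J.slice B).ver j) ≫ v),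
        (ExponentiableMorphism.pullbackPushforwardAdj f).homEquiv _ _
            (F.solveLeft (φ.slice A) j k u v e) =
          (Φ F).solveRight (φ.slice B) j k
            ((ExponentiableMorphism.pullbackPushforwardAdj f).homEquiv _ _ u)
            ((ExponentiableMorphism.pullbackPushforwardAdj f).homEquiv _ _ v)
            (DoubleLifting.transpose_comm (ExponentiableMorphism.pullbackPushforwardAdj f) e) := by
  have hL := hφ.1.isBijective
  have hR := hφ.2.isBijective
  obtain ⟨Ψ₁, hΨ₁⟩ := DoubleLifting.FunctorLift.exists_equiv_of_toLeftDual
    (H := ChosenPullbacksAlong.pullback f) (J := J.slice B)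
    (DoubleLifting.LiftingOperation.isBijective_toLeftDual_slice hL
      (DoubleLifting.LiftingOperation.hasPullbackSquares hR) hR.obj hR.map A)
  obtain ⟨Ψ₂, hΨ₂⟩ := DoubleLifting.FunctorLift.exists_equiv_of_toRightDual
    (H := ExponentiableMorphism.pushforward f) (J := K.slice A)
    (DoubleLifting.LiftingOperation.isBijective_toRightDual_slice hR B)
  let adj := ExponentiableMorphism.pullbackPushforwardAdj f
  refine ⟨(Ψ₁.trans (DoubleLifting.LiftingOperation.transpose adj)).trans Ψ₂.symm, ?_⟩
  intro F b b' j a a' k u v e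
  rw [DoubleLifting.FunctorLift.solveRight_eq _ _
      (DoubleLifting.LiftingOperation.transpose adj (Ψ₁ F)) (by rw [← hΨ₂]; simp),
    F.solveLeft_eq _ (Ψ₁ F) (hΨ₁ F)]
  simp [DoubleLifting.LiftingOperation.transpose, adj]
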